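/- **Theorem 3.2.** Let $X=[0,1]$ with Lebesgue measure $dx$, and write $H=L^2([0,1])$ (real-valued), $\|\cdot\|$ for its norm. Let $\eta$ be the standard Gaussian white noise on $[0,1]$: a generalized random process $h\mapsto\langle h,\eta\rangle$, $h\in H$, on a probability space $(\Omega,\mu)$, almost surely linear in $h$, with $\mathbb E\,e^{i\langle h,\eta\rangle}=e^{-\|h\|^2/2}$, the $\sigma$-algebra of $\Omega$ being generated by the process up to null sets; $L^2(\alpha)=L^2(\Omega,\mu;\mathbb C)$. Let $P$ be the law of the Poisson point process on $[0,1]$ with mean measure $dx$, on the space $\mathcal E$ of finite point configurations $\omega$ in $[0,1]$ with the $\sigma$-algebra generated by the counts $\#(\omega\cap A)$, $A$ measurable; $L^2(\pi)=L^2(\mathcal E,P;\mathbb C)$. There is exactly one isometric isomorphism $\Phi:L^2(\alpha)\to L^2(\pi)$ with $$\Phi\left(e^{\langle h,\cdot\rangle-\|h\|^2/2}\right)(\omega)=\prod_{x\in\omega}(1+h(x))\cdot e^{-\int_0^1 h(x)\,dx}\qquad\text{for all }h\in H .$$ Its kernel, in the sense that $(\Phi^{-1}F)(\eta)=\int_{\mathcal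 E}K(\omega,\eta)F(\omega)\,dP(\omega)$ for every $F\in L^2(\pi)$, is the generalized function $$K(\omega,\eta)=e^{-\frac12-\langle 1,\eta\rangle}\sum_{R\in\Pi_{\le2}(\omega)}(-1)^{|R|}\prod_{z\in C_1(R)}(\eta+2)(z)\prod_{\{x,y\}\in C_2(R)}\delta(x-y).$$ Here $\Pi_{\le2}(\omega)$ is the set of partitions of $\omega$ into blocks of at most two points, $C_k(R)$ is the set of $k$-point blocks of $R$, $|R|=\#C_2(R)$, and the products are direct products of generalized functions. That is, $K(\{x_1,\dots,x_n\},\eta)$ acts on $f_1\otimes\cdots\otimes f_n$, $f_i\in H$, by $$\langle K_n(\eta),f_1\otimes\cdots\otimes f_n\rangle=e^{-\frac12-\langle 1,\eta\rangle}\sum_{R}(-1)^{|R|}\prod_{\{i\}\in R}\Big(\langle f_i,\eta\rangle+2\int_0^1 f_i\,dx\Big)\prod_{\{i,j\}\in R}\int_0^1 f_if_j\,dx ,$$ $R$ running over the partitions of $\{1,\dots,n\}$ into blocks of at most two elements. The integral against $K$ means $$\int_{\mathcal E}K(\omega,\eta)F(\omega)\,dP(\omega)=\sum_{n\ge0}\frac{e^{-1}}{n!}\,\langle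 K_n(\eta),F_n\rangle,\qquad F_n(x_1,\dots,x_n)=F(\{x_1,\dots,x_n\}),$$ where the series converges unconditionally in $L^2(\alpha)$ and $\langle K_n(\eta),u\rangle$, for $u=F_n\in L^2([0,1]^n;\mathbb C)$, is the extension by closure from finite complex linear combinations of products: $\langle K_n,u\rangle=g$ means that there are such combinations $T_k$ with $T_k\to u$ in $L^2([0,1]^n)$ and $\langle K_n,T_k\rangle\to g$ in $L^2(\alpha)$. For $F\in L^2(\pi)$ and $G\in L^2(\alpha)$, $G$ is a value of this integral if and only if $G=\Phi^{-1}F$ (so the integral exists and is unique for every $F$). -/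

import Mathlib

open MeasureTheory ProbabilityTheory Filter Topology
open scoped NNReal ENNReal Nat

noncomputable section

namespace PoissonGauss

/-- The real Hilbert space `L²([0,1])` for Lebesgue measure. -/
abbrev H : Type := Lp ℝ 2 (volume : Measure unitInterval)

/-! ### Gaussian white noise -/

/-- `W` is the standard Gaussian white noise on `([0,1], dx)`, realized on the probability space
`(Ω, μ)`: a generalized random process `h ↦ ⟨h, η⟩ = W h η` on the Hilbert space `L²([0,1])`, almost
surely linear in `h`, with characteristic functional `𝔼 exp(i⟨h, η⟩) = exp(-‖h‖²/2)`. By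
`generates`, the σ-algebra of `Ω` is, up to null sets, the one generated by the process, so that
`Lp ℂ 2 μ` is the space of square integrable functionals of the white noise. -/
structure IsWhiteNoise {Ω : Type*} [MeasurableSpace Ω] (μ : Measure Ω) (W : H → Ω → ℝ) :
    Prop where
  measurable : ∀ h, Measurable (W h)
  linear : ∀ (a b : ℝ) (h k : H),
    W (a • h + b • k) =ᵐ[μ] fun η => a * W h η + b * W k η
  charFunctional : ∀ h : H,
    ∫ η, Complex.exp (Complex.I * (W h η : ℂ)) ∂μ = Complex.exp (-((‖h‖ : ℂ) ^ 2) / 2)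
  generates : ∀ s : Set Ω, MeasurableSet s →
    ∃ t : Set Ω, MeasurableSet[⨆ h, MeasurableSpace.comap (W h) inferInstance] t ∧ s =ᵐ[μ] t

/-! ### Poisson process -/

/-- Finite point configurations in `[0,1]`, with multiplicities. (The mean measure is finite, so
configurations of the process are almost surely finite.) -/
abbrev Config : Type := Multiset unitInterval

open Classical in
/-- The number `#(ω ∩ A)` of points of `ω` in `A`, counted with multiplicities. -/
def count (A : Set unitInterval) (ω : Config) : ℕ := ω.countP (· ∈ A)

/-- The σ-algebra on configurations generated by the counting variables of measurable sets. -/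
instance : MeasurableSpace Config :=
  ⨆ (A : Set unitInterval) (_ : MeasurableSet A), MeasurableSpace.comap (count A) ⊤

/-- `P` is the law of the Poisson point process on `[0,1]` whose mean measure is Lebesgue measure. -/
structure IsPoissonProcess (P : Measure Config) : Prop where
  law : ∀ A : Set unitInterval, MeasurableSet A →
    P.map (count A) = poissonMeasure (volume A).toNNReal
  indep : ∀ (n : ℕ) (A : Fin n → Set unitInterval), (∀ i, MeasurableSet (A i)) →
    Pairwise (fun i j => Disjoint (A i) (A j)) → iIndepFun (fun i => count (A i)) P

/-! ### The canonical isometry -/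

/-- `Φ : L²(α) → L²(π)` sends, for all `h ∈ L²([0,1])`, the functional `exp(⟨h, η⟩ - ‖h‖²/2)` of the
white noise to the functional `∏_{x ∈ ω} (1 + h(x)) · exp(-∫ h dx)` of the Poisson process. -/
def IsCanonicalIsometry {Ω : Type*} [MeasurableSpace Ω] {μ : Measure Ω} (W : H → Ω → ℝ)
    {P : Measure Config} (Φ : Lp ℂ 2 μ ≃ₗᵢ[ℂ] Lp ℂ 2 P) : Prop :=
  ∀ (h : H) (E : Lp ℂ 2 μ),
    (E =ᵐ[μ] fun η => (Real.exp (W h η - ‖h‖ ^ 2 / 2) : ℂ)) →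
      (Φ E =ᵐ[P] fun ω =>
        (((ω.map fun x => 1 + h x).prod * Real.exp (-∫ x, h x) : ℝ) : ℂ))

/-! ### Generalized kernels on configurations × noise

A random generalized function `K(ω, η)` on configurations is a family, indexed by `n`, of
(symmetric) generalized functions `K({x₁, …, xₙ}, η)` of `n` points. It is given by its values
on the products `f₁ ⊗ ⋯ ⊗ fₙ`, `fᵢ ∈ L²([0,1])`, i.e. by the random variables
`∫⋯∫ K({x₁, …, xₙ}, η) f₁(x₁) ⋯ fₙ(xₙ) dx₁ ⋯ dxₙ`. -/

/-- A random generalized function of finitely many points, through its values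
`K n f η = ⟨K({x₁, …, xₙ}, η), f₁ ⊗ ⋯ ⊗ fₙ⟩`. -/
abbrev GenKernel (Ω : Type*) : Type _ := (n : ℕ) → (Fin n → H) → Ω → ℝ

/-- The generalized function `η + 2`: `⟨η + 2, f⟩ = ⟨η, f⟩ + 2 ∫ f dx`. -/
def noisePlusTwo {Ω : Type*} (W : H → Ω → ℝ) (η : Ω) (f : H) : ℝ := W f η + 2 * ∫ x, f x

/-- The generalized function `δ(x - y)`, in the variables `x = x_i`, `y = x_j` for a pair
`B = {i, j}`, on `f_i ⊗ f_j`: `∫∫ δ(x - y) f_i(x) f_j(y) dx dy = ∫ f_i(x) f_j(x) dx`. -/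
def pairDelta {n : ℕ} (f : Fin n → H) (B : Finset (Fin n)) : ℝ := ∫ x, ∏ i ∈ B, f i x

/-- `Π_{≤2}`: the partitions of the `n`-point set `{x₁, …, xₙ}` (of its index set) into blocks of
at most two points. -/
def partitionsLeTwo (n : ℕ) : Finset (Finpartition (Finset.univ : Finset (Fin n))) :=
  {R | ∀ B ∈ R.parts, B.card ≤ 2}

/-- `C₂(R)`: the two-point blocks of the partition `R`. -/
def pairs {n : ℕ} (R : Finpartition (Finset.univ : Finset (Fin n))) : Finset (Finset (Fin n)) :=
  {B ∈ R.parts | B.card = 2}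

/-- `C₁(R)`: the points forming one-point blocks of the partition `R`. -/
def singletons {n : ℕ} (R : Finpartition (Finset.univ : Finset (Fin n))) : Finset (Fin n) :=
  {i | {i} ∈ R.parts}

/-- The generalized function
`e^{-1/2 - ⟨η,1⟩} ∑_{R ∈ Π_{≤2}(ω)} (-1)^{|R|} ∏_{z ∈ C₁(R)} (η+2)(z) ∏_{{x,y} ∈ C₂(R)} δ(x-y)`,
the product being the direct product of generalized functions (in disjoint sets of variables). -/
def kernel {Ω : Type*} (W : H → Ω → ℝ) : GenKernel Ω := fun n f η =>
  Real.exp (-1 / 2 - W (Lp.const 2 volume 1) η) *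
    ∑ R ∈ partitionsLeTwo n, (-1) ^ (pairs R).card *
      (∏ z ∈ singletons R, noisePlusTwo W η (f z)) * ∏ B ∈ pairs R, pairDelta f B

/-- The test function on `[0,1]ⁿ` given by a formal complex linear combination of products
`f₁ ⊗ ⋯ ⊗ fₙ`. -/
def testFun {n : ℕ} (T : (Fin n → H) →₀ ℂ) (x : Fin n → unitInterval) : ℂ :=
  T.sum fun f c => c * ∏ i, (f i (x i) : ℂ)

/-- The value of `K({x₁, …, xₙ}, η)` on such a linear combination. -/
def GenKernel.apply {Ω : Type*} (K : GenKernel Ω) {n : ℕ} (T : (Fin n → H) →₀ ℂ) (η : Ω) : ℂ :=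
  T.sum fun f c => c * (K n f η : ℂ)

/-- `G(η) = ∫⋯∫ K({x₁, …, xₙ}, η) u(x₁, …, xₙ) dx₁ ⋯ dxₙ` for `u ∈ L²([0,1]ⁿ)`, as an element of
`L²(μ)`: the extension by continuity (closure of the graph) from linear combinations of products,
in the norms of `L²([0,1]ⁿ)` and `L²(μ)`. -/
def GenKernel.HasSectorIntegral {Ω : Type*} [MeasurableSpace Ω] {μ : Measure Ω} (K : GenKernel Ω)
    (n : ℕ) (u : (Fin n → unitInterval) → ℂ) (G : Lp ℂ 2 μ) : Prop :=
  ∃ T : ℕ → ((Fin n → H) →₀ ℂ),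
    Tendsto (fun k => eLpNorm (fun x => testFun (T k) x - u x) 2 volume) atTop (𝓝 0) ∧
    Tendsto (fun k => eLpNorm (fun η => K.apply (T k) η - G η) 2 μ) atTop (𝓝 0)

/-- The configuration `{x₁, …, xₙ}`. -/
def toConfig {n : ℕ} (x : Fin n → unitInterval) : Config := Finset.univ.val.map x

/-- `G(η) = ∫ K(ω, η) F(ω) dP(ω)` for the law `P` of the Poisson process of unit rate on `[0,1]`
and a square integrable functional `F`. As the process has `n` points with probability `e⁻¹/n!`,
these being then independent and uniform, the integral is
`∑ₙ (e⁻¹/n!) ∫⋯∫ K({x₁, …, xₙ}, η) F({x₁, …, xₙ}) dx₁ ⋯ dxₙ`; the series converges in `L²(μ)`. -/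
def GenKernel.HasIntegral {Ω : Type*} [MeasurableSpace Ω] {μ : Measure Ω} (K : GenKernel Ω)
    (F : Config → ℂ) (G : Lp ℂ 2 μ) : Prop :=
  ∃ g : ℕ → Lp ℂ 2 μ, (∀ n, K.HasSectorIntegral n (fun x => F (toConfig x)) (g n)) ∧
    HasSum (fun n => ((Real.exp (-1) / (n ! : ℝ) : ℝ) : ℂ) • g n) G

end PoissonGauss

end

open PoissonGauss

/-! Existence and uniqueness of `Φ`: the Gaussian and the Poisson exponentials indexed by `h ∈ H`
both have Gram matrix `exp ⟨h, k⟩`, and both families are total, since a function orthogonal to all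
exponentials of a generating process vanishes. Two total families with equal Gram matrices are
matched by exactly one unitary.

Kernel: the Poisson law is the mixture of uniform `n`-point samples with weights `e⁻¹/n!`
(`IsPoissonProcess.eq_uniformMixture`). Writing `Sₙ` for restriction to `n`-point configurations
(`sector`), Parseval gives `F = ∑ₙ (e⁻¹/n!) Sₙ* Sₙ F`. Each `Φ⁻¹ Sₙ*` is bounded, so the claim
reduces to `Φ⁻¹ Sₙ* (f₁ ⊗ ⋯ ⊗ fₙ) = ⟨Kₙ, f₁ ⊗ ⋯ ⊗ fₙ⟩` (`symm_adjoint_sector_prodLp`), which is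
checked by pairing with the exponentials. On the Poisson side the pairing is `e^{-∫k} ∏ᵢ ∫ (1 + k)
fᵢ`.

On the Gaussian side the partition sum is a Wick product of the variables `⟨fᵢ, η⟩`, each shifted by
a constant `cᵢ`, and `𝔼[e^{⟨k, η⟩} · Wick] = e^{‖k‖²/2} ∏ᵢ (⟨k, fᵢ⟩ + cᵢ)`
(`integral_exp_mul_partitionSum`). The factor `e^{-⟨1, η⟩}` replaces `k` by `k - 1`, so `cᵢ = 2 ∫
fᵢ` is what produces `∫ (1 + k) fᵢ`; this is the origin of `η + 2`. -/

namespace PoissonGauss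

/-! ### Measures and `L²` functions determined by exponential moments -/

section ExponentialMoments

variable {Ω ι : Type*} [MeasurableSpace Ω]

/-- Moment generating functions finite on all of `ℝ` extend analytically to `ℂ`; the identity
theorem then gives equality at `i`. -/
theorem integral_cexp_mul_I_eq_of_mgf_eq {μ ν : Measure Ω} [IsFiniteMeasure μ]
    [IsFiniteMeasure ν] {X : Ω → ℝ} (hμ : ∀ t, Integrable (fun ω => Real.exp (t * X ω)) μ)
    (h : mgf X μ = mgf X ν) :
    ∫ ω, Complex.exp (X ω * Complex.I) ∂μ = ∫ ω, Complex.exp (X ω * Complex.I) ∂ν := by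
  -- The total masses agree, being the values of the moment generating functions at 0.
  have h0 : μ = 0 ↔ ν = 0 := by
    have := congrFun h 0
    simp only [mgf_zero'] at this
    rw [← Measure.measure_univ_eq_zero, ← Measure.measure_univ_eq_zero,
      ← measureReal_eq_zero_iff, this, measureReal_eq_zero_iff]
  have hset : integrableExpSet X μ = Set.univ := Set.eq_univ_of_forall hμ
  have key := eqOn_complexMGF_of_mgf' h h0 (x := Complex.I) (by simp [hset])
  simpa [complexMGF, mul_comm] using key

/-- A law on a product space is determined by its finite-dimensional marginals, and these by their
characteristic functions, to which the one-variable result applies along each linear functional. -/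
theorem map_eq_map_of_integral_exp_eq {μ ν : Measure Ω} [IsFiniteMeasure μ]
    [IsFiniteMeasure ν] {X : ι → Ω → ℝ} (hX : ∀ i, Measurable (X i))
    (hμ : ∀ (I : Finset ι) (t : ι → ℝ), Integrable (fun ω => Real.exp (∑ i ∈ I, t i * X i ω)) μ)
    (h : ∀ (I : Finset ι) (t : ι → ℝ), ∫ ω, Real.exp (∑ i ∈ I, t i * X i ω) ∂μ =
      ∫ ω, Real.exp (∑ i ∈ I, t i * X i ω) ∂ν) :
    μ.map (fun ω i => X i ω) = ν.map (fun ω i => X i ω) := by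
  classical
  have hXm : Measurable (fun ω i => X i ω) := measurable_pi_lambda _ hX
  refine IsProjectiveLimit.unique (P := fun I => (μ.map (fun ω i => X i ω)).map I.restrict)
    (fun I => rfl) fun I => ?_
  beta_reduce
  rw [Measure.map_map (by fun_prop) hXm, Measure.map_map (by fun_prop) hXm]
  have hm : Measurable (I.restrict ∘ fun ω i => X i ω) := (by fun_prop : Measurable I.restrict).comp hXm
  refine Measure.ext_of_charFunDual ?_
  ext L
  rw [charFunDual_apply, charFunDual_apply,
    integral_map hm.aemeasurable (by fun_prop), integral_map hm.aemeasurable (by fun_prop)]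
  -- The coefficients of `L` in the coordinates of `I`, extended by 0.
  set t : ι → ℝ := fun i => if hi : i ∈ I then L (Pi.single ⟨i, hi⟩ 1) else 0 with ht
  have hL : ∀ ω, L (I.restrict fun i => X i ω) = ∑ i ∈ I, t i * X i ω := by
    intro ω
    have : (I.restrict fun i => X i ω) = ∑ i : I, X i ω • (Pi.single i (1 : ℝ) : I → ℝ) := by
      ext j
      simp [Finset.sum_apply, Pi.single_apply]
    rw [this, map_sum, ← Finset.sum_coe_sort I]
    refine Finset.sum_congr rfl fun i _ => ?_
    simp [ht, mul_comm]
  simp only [Function.comp_apply, hL]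
  have hs : ∀ s ω, s * (∑ i ∈ I, t i * X i ω) = ∑ i ∈ I, (s * t i) * X i ω := by
    intro s ω; rw [Finset.mul_sum]; simp [mul_assoc]
  symm
  refine integral_cexp_mul_I_eq_of_mgf_eq (X := fun ω => ∑ i ∈ I, t i * X i ω) (fun s => ?_) ?_
  · simp only [hs]; exact hμ I _
  · ext s
    simp only [mgf, hs]
    exact h I _

theorem measure_eq_of_integral_exp_eq {μ ν : Measure Ω} [IsFiniteMeasure μ]
    [IsFiniteMeasure ν] {X : ι → Ω → ℝ} (hX : ∀ i, Measurable (X i))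
    (hμ : ∀ (I : Finset ι) (t : ι → ℝ), Integrable (fun ω => Real.exp (∑ i ∈ I, t i * X i ω)) μ)
    (h : ∀ (I : Finset ι) (t : ι → ℝ), ∫ ω, Real.exp (∑ i ∈ I, t i * X i ω) ∂μ =
      ∫ ω, Real.exp (∑ i ∈ I, t i * X i ω) ∂ν) {s : Set Ω}
    (hs : MeasurableSet[⨆ i, MeasurableSpace.comap (X i) inferInstance] s) : μ s = ν s := by
  have hXm : Measurable (fun ω i => X i ω) := measurable_pi_lambda _ hX
  have hc : (⨆ i, MeasurableSpace.comap (X i) inferInstance) =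
      MeasurableSpace.comap (fun ω i => X i ω) MeasurableSpace.pi := by
    simp only [MeasurableSpace.pi, MeasurableSpace.comap_iSup, MeasurableSpace.comap_comp]
    rfl
  rw [hc] at hs
  obtain ⟨t, ht, rfl⟩ := hs
  rw [← Measure.map_apply hXm ht, ← Measure.map_apply hXm ht,
    map_eq_map_of_integral_exp_eq hX hμ h]

/-- The finite measures with densities `f⁺` and `f⁻` have equal exponential moments, so they agree
on the σ-algebra generated by `X`. As this is everything up to null sets, `f` integrates to 0 over
every measurable set. -/
theorem ae_eq_zero_of_integral_mul_exp_eq_zero {μ : Measure Ω} [IsFiniteMeasure μ]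
    {X : ι → Ω → ℝ} (hX : ∀ i, Measurable (X i))
    (hμ : ∀ (I : Finset ι) (t : ι → ℝ), MemLp (fun ω => Real.exp (∑ i ∈ I, t i * X i ω)) 2 μ)
    (hgen : ∀ s : Set Ω, MeasurableSet s →
      ∃ t, MeasurableSet[⨆ i, MeasurableSpace.comap (X i) inferInstance] t ∧ s =ᵐ[μ] t)
    {f : Ω → ℝ} (hf : MemLp f 2 μ)
    (h : ∀ (I : Finset ι) (t : ι → ℝ), ∫ ω, f ω * Real.exp (∑ i ∈ I, t i * X i ω) ∂μ = 0) :
    f =ᵐ[μ] 0 := by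
  have hfi : Integrable f μ := hf.integrable (by norm_num)
  have hm : AEMeasurable f μ := hf.1.aemeasurable
  set ν₁ := μ.withDensity fun ω => ENNReal.ofReal (f ω) with hν₁
  set ν₂ := μ.withDensity fun ω => ENNReal.ofReal (-f ω) with hν₂
  have : IsFiniteMeasure ν₁ := isFiniteMeasure_withDensity_ofReal hfi.2
  have : IsFiniteMeasure ν₂ := isFiniteMeasure_withDensity_ofReal hfi.neg.2
  have hmul : ∀ (I : Finset ι) (t : ι → ℝ),
      Integrable (fun ω => f ω * Real.exp (∑ i ∈ I, t i * X i ω)) μ := fun I t =>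
    hf.integrable_mul (hμ I t)
  have hd : ∀ (g : Ω → ℝ), AEMeasurable g μ → ∀ (u : Ω → ℝ),
      ∫ ω, u ω ∂(μ.withDensity fun ω => ENNReal.ofReal (g ω)) = ∫ ω, max (g ω) 0 * u ω ∂μ := by
    intro g hg u
    rw [integral_withDensity_eq_integral_toReal_smul₀ (by fun_prop)
      (Eventually.of_forall fun _ => ENNReal.ofReal_lt_top)]
    simp [ENNReal.toReal_ofReal']
  have hd' : ∀ (g : Ω → ℝ), AEMeasurable g μ → ∀ (u : Ω → ℝ), AEStronglyMeasurable u μ →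
      Integrable (fun ω => g ω * u ω) μ → Integrable (fun ω => max (g ω) 0 * u ω) μ := by
    intro g hg u hu hgu
    refine hgu.mono ((hg.max aemeasurable_const).aestronglyMeasurable.mul hu)
      (Eventually.of_forall fun ω => ?_)
    simp only [norm_mul, Real.norm_eq_abs]
    refine mul_le_mul_of_nonneg_right ?_ (abs_nonneg _)
    rw [abs_of_nonneg (le_max_right _ _)]
    exact max_le (le_abs_self _) (abs_nonneg _)
  have key : ∀ s, MeasurableSet[⨆ i, MeasurableSpace.comap (X i) inferInstance] s →
      ν₁ s = ν₂ s := by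
    intro s hs
    refine measure_eq_of_integral_exp_eq hX (fun I t => ?_) (fun I t => ?_) hs
    · rw [hν₁, integrable_withDensity_iff_integrable_smul₀' (by fun_prop)
        (Eventually.of_forall fun _ => ENNReal.ofReal_lt_top)]
      simpa [ENNReal.toReal_ofReal'] using hd' f hm _ (hμ I t).1 (hmul I t)
    · rw [hd f hm, hd (fun ω => -f ω) hm.neg, ← sub_eq_zero, ← integral_sub]
      · refine (integral_congr_ae (Eventually.of_forall fun ω => ?_)).trans (h I t)
        rcases le_total (f ω) 0 with h | h <;> simp [h]
      · exact hd' f hm _ (hμ I t).1 (hmul I t)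
      · refine hd' _ hm.neg _ (hμ I t).1 ?_
        simpa using (hmul I t).neg
  refine hfi.ae_eq_zero_of_forall_setIntegral_eq_zero fun s hs _ => ?_
  obtain ⟨t, ht, hst⟩ := hgen s hs
  have htm : MeasurableSet t := (iSup_le fun i => (hX i).comap_le) _ ht
  rw [setIntegral_congr_set hst, integral_eq_lintegral_pos_part_sub_lintegral_neg_part
    hfi.integrableOn, ← withDensity_apply _ htm, ← withDensity_apply _ htm, sub_eq_zero]
  exact congrArg _ (key t ht)

theorem ae_eq_zero_of_integral_mul_cexp_eq_zero {μ : Measure Ω} [IsFiniteMeasure μ]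
    {X : ι → Ω → ℝ} (hX : ∀ i, Measurable (X i))
    (hμ : ∀ (I : Finset ι) (t : ι → ℝ), MemLp (fun ω => Real.exp (∑ i ∈ I, t i * X i ω)) 2 μ)
    (hgen : ∀ s : Set Ω, MeasurableSet s →
      ∃ t, MeasurableSet[⨆ i, MeasurableSpace.comap (X i) inferInstance] t ∧ s =ᵐ[μ] t)
    {f : Ω → ℂ} (hf : MemLp f 2 μ)
    (h : ∀ (I : Finset ι) (t : ι → ℝ),
      ∫ ω, (Real.exp (∑ i ∈ I, t i * X i ω) : ℂ) * f ω ∂μ = 0) :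
    f =ᵐ[μ] 0 := by
  have hint : ∀ (I : Finset ι) (t : ι → ℝ),
      Integrable (fun ω => (Real.exp (∑ i ∈ I, t i * X i ω) : ℂ) * f ω) μ := fun I t =>
    (hμ I t).ofReal.integrable_mul hf
  have hre : (fun ω => (f ω).re) =ᵐ[μ] 0 := by
    refine ae_eq_zero_of_integral_mul_exp_eq_zero hX hμ hgen hf.re fun I t => ?_
    have := congrArg Complex.re (h I t)
    rw [← RCLike.re_eq_complex_re, ← integral_re (hint I t)] at this
    simpa [mul_comm, -Complex.ofReal_exp] using this
  have him : (fun ω => (f ω).im) =ᵐ[μ] 0 := by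
    refine ae_eq_zero_of_integral_mul_exp_eq_zero hX hμ hgen hf.im fun I t => ?_
    have := congrArg Complex.im (h I t)
    rw [← RCLike.im_eq_complex_im, ← integral_im (hint I t)] at this
    simpa [mul_comm, -Complex.ofReal_exp] using this
  filter_upwards [hre, him] with ω h1 h2
  exact Complex.ext h1 h2

end ExponentialMoments

/-! ### Products over configurations -/

theorem measurable_count {A : Set unitInterval} (hA : MeasurableSet A) : Measurable (count A) := by
  have h : MeasurableSpace.comap (count A) ⊤ ≤ (inferInstance : MeasurableSpace Config) :=
    le_iSup₂_of_le (f := fun (A : Set unitInterval) (_ : MeasurableSet A) =>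
      MeasurableSpace.comap (count A) ⊤) A hA le_rfl
  exact (comap_measurable (count A)).mono h le_rfl

theorem measurableSpace_config_le :
    (inferInstance : MeasurableSpace Config) ≤
      ⨆ A : {A : Set unitInterval // MeasurableSet A},
        MeasurableSpace.comap (fun ω => (count A ω : ℝ)) inferInstance := by
  refine iSup₂_le fun A hA => le_iSup_of_le ⟨A, hA⟩ ?_
  have : (⊤ : MeasurableSpace ℕ) = MeasurableSpace.comap (Nat.cast : ℕ → ℝ) inferInstance :=
    Nat.isClosedEmbedding_coe_real.measurableEmbedding.comap_eq.symm
  rw [this, MeasurableSpace.comap_comp]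
  rfl

theorem count_cons (A : Set unitInterval) (a : unitInterval) (ω : Config) :
    count A (a ::ₘ ω) = count A ω + A.indicator 1 a := by
  classical
  simp only [count, Multiset.countP_cons, Set.indicator_apply, Pi.one_apply]

/-- Grouping the points by level set makes the product a function of counts of disjoint sets, whose
joint law the Poisson axioms prescribe. -/
theorem map_prod_eq_prod_pow_count (s : SimpleFunc unitInterval ℝ) (ω : Config) :
    (ω.map s).prod = ∏ c ∈ s.range, c ^ count (s ⁻¹' {c}) ω := by
  induction ω using Multiset.induction with
  | empty => simp [count]
  | cons a ω ih =>
    simp only [Multiset.map_cons, Multiset.prod_cons, ih, count_cons, pow_add,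
      Finset.prod_mul_distrib]
    rw [mul_comm]
    congr 1
    rw [Finset.prod_eq_single_of_mem (s a) (s.mem_range_self a)]
    · simp
    · intro b _ hb
      simp [Set.indicator_of_notMem (show a ∉ s ⁻¹' {b} from fun h => hb h.symm)]

theorem measurable_map_prod {g : unitInterval → ℝ} (hg : Measurable g) :
    Measurable fun ω : Config => (ω.map g).prod := by
  have hs := hg.stronglyMeasurable
  refine measurable_of_tendsto_metrizable (f := fun n (ω : Config) => (ω.map (hs.approx n)).prod)
    (fun n => ?_) (tendsto_pi_nhds.2 fun ω => ?_)
  · simp only [map_prod_eq_prod_pow_count]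
    exact Finset.measurable_prod _ fun c _ =>
      measurable_const.pow (measurable_count ((hs.approx n).measurableSet_fiber c))
  · exact tendsto_multiset_prod _ fun x _ => hs.tendsto_approx x

theorem count_toConfig (A : Set unitInterval) {n : ℕ} (x : Fin n → unitInterval) :
    count A (toConfig x) = ∑ i, A.indicator 1 (x i) := by
  classical
  rw [toConfig, count, Multiset.countP_map]
  simp only [Set.indicator_apply, Pi.one_apply, Finset.sum_boole, Nat.cast_id]
  rfl

theorem map_toConfig_prod {n : ℕ} (g : unitInterval → ℝ) (x : Fin n → unitInterval) :
    ((toConfig x).map g).prod = ∏ i, g (x i) := by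
  rw [toConfig, Multiset.map_map]
  rfl

theorem measurable_toConfig (n : ℕ) :
    Measurable (toConfig : (Fin n → unitInterval) → Config) := by
  refine Measurable.of_le_map (iSup₂_le fun A hA => ?_)
  rw [MeasurableSpace.comap_le_iff_le_map, MeasurableSpace.map_comp]
  have : Measurable fun x : Fin n → unitInterval => count A (toConfig x) := by
    simp only [count_toConfig]
    exact Finset.measurable_sum _ fun i _ =>
      ((measurable_const (a := (1 : ℕ))).indicator hA).comp (measurable_pi_apply i)
  exact this.le_map

/-! ### The Poisson law as a mixture of uniform samples -/

/-- The probability `e⁻¹ / n!` of having `n` points. -/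
noncomputable def sectorWeight (n : ℕ) : ℝ := Real.exp (-1) / (n ! : ℝ)

theorem sectorWeight_pos (n : ℕ) : 0 < sectorWeight n := by
  unfold sectorWeight; positivity

theorem hasSum_sectorWeight_mul_pow (a : ℝ) :
    HasSum (fun n => sectorWeight n * a ^ n) (Real.exp (a - 1)) := by
  have := (NormedSpace.expSeries_div_hasSum_exp (a : ℝ)).mul_left (Real.exp (-1))
  rw [← Real.exp_eq_exp_ℝ, ← Real.exp_add, neg_add_eq_sub] at this
  convert! this using 2
  rw [sectorWeight]
  ring

/-- A Poisson number of independent uniform points. -/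
noncomputable def uniformMixture : Measure Config :=
  Measure.sum fun n => ENNReal.ofReal (sectorWeight n) •
    (volume : Measure (Fin n → unitInterval)).map toConfig

theorem lintegral_uniformMixture {u : Config → ℝ≥0∞} (hu : Measurable u) :
    ∫⁻ ω, u ω ∂uniformMixture =
      ∑' n, ENNReal.ofReal (sectorWeight n) * ∫⁻ x : Fin n → unitInterval, u (toConfig x) := by
  rw [uniformMixture, lintegral_sum_measure]
  refine tsum_congr fun n => ?_
  rw [lintegral_smul_measure, lintegral_map hu (measurable_toConfig n), smul_eq_mul]

instance : IsFiniteMeasure uniformMixture := by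
  refine ⟨?_⟩
  have h := lintegral_uniformMixture (u := fun _ => 1) measurable_const
  simp only [lintegral_const, one_mul, measure_univ, mul_one] at h
  rw [h, ← ENNReal.ofReal_tsum_of_nonneg (fun n => (sectorWeight_pos n).le)
    (by simpa using (hasSum_sectorWeight_mul_pow 1).summable)]
  exact ENNReal.ofReal_lt_top

theorem hasSum_integral_uniformMixture {E : Type*} [NormedAddCommGroup E] [NormedSpace ℝ E]
    {u : Config → E} (hu : Integrable u uniformMixture) :
    HasSum (fun n => sectorWeight n • ∫ x : Fin n → unitInterval, u (toConfig x))
      (∫ ω, u ω ∂uniformMixture) := by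
  have h := hasSum_integral_measure hu
  convert! h using 2 with n
  rw [integral_smul_measure, ENNReal.toReal_ofReal (sectorWeight_pos n).le,
    integral_map (measurable_toConfig n).aemeasurable]
  have hle := Measure.le_sum (fun n => ENNReal.ofReal (sectorWeight n) •
    (volume : Measure (Fin n → unitInterval)).map toConfig) n
  refine (hu.1.mono_measure hle).mono_ac ?_
  exact Measure.absolutelyContinuous_smul (by simp [sectorWeight_pos])

/-- The `n`-point sector contributes `(e⁻¹/n!) (∫ g)ⁿ`, and these sum to an exponential; with `|g|`
the same series gives integrability. -/
theorem integrable_map_prod_and_integral {g : unitInterval → ℝ} (hg : Measurable g)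
    (hgi : Integrable g) :
    Integrable (fun ω : Config => (ω.map g).prod) uniformMixture ∧
      ∫ ω : Config, (ω.map g).prod ∂uniformMixture = Real.exp (∫ x, g x - 1) := by
  have hi : Integrable (fun ω : Config => (ω.map g).prod) uniformMixture := by
    refine ⟨(measurable_map_prod hg).aestronglyMeasurable, ?_⟩
    rw [hasFiniteIntegral_iff_enorm, lintegral_uniformMixture (measurable_map_prod hg).enorm]
    have : ∀ n, ∫⁻ x : Fin n → unitInterval, ‖((toConfig x).map g).prod‖ₑ =
        ENNReal.ofReal ((∫ x, ‖g x‖) ^ n) := by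
      intro n
      simp only [map_toConfig_prod]
      have h1 : Integrable (fun x : Fin n → unitInterval => ∏ i, g (x i)) :=
        Integrable.fintype_prod fun _ => hgi
      rw [← ofReal_integral_norm_eq_lintegral_enorm h1]
      simp only [norm_prod]
      rw [integral_fintype_prod_volume_eq_pow (fun x => ‖g x‖), Fintype.card_fin]
    simp only [this, ← ENNReal.ofReal_mul (sectorWeight_pos _).le]
    rw [← ENNReal.ofReal_tsum_of_nonneg
      (fun n => mul_nonneg (sectorWeight_pos n).le (by positivity))
      (hasSum_sectorWeight_mul_pow _).summable]
    exact ENNReal.ofReal_lt_top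
  refine ⟨hi, (hasSum_integral_uniformMixture hi).unique ?_⟩
  rw [integral_sub hgi (integrable_const _)]
  simp only [map_toConfig_prod, smul_eq_mul, integral_fintype_prod_volume_eq_pow, Fintype.card_fin]
  simpa using hasSum_sectorWeight_mul_pow (∫ x, g x)

theorem lintegral_pow_poissonMeasure (r : ℝ≥0) {c : ℝ} (hc : 0 ≤ c) :
    ∫⁻ n, ENNReal.ofReal c ^ n ∂poissonMeasure r = ENNReal.ofReal (Real.exp ((c - 1) * r)) := by
  have hs : HasSum (fun n : ℕ => (Real.exp (-r) * r ^ n / n !) * c ^ n)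
      (Real.exp ((c - 1) * r)) := by
    have := (NormedSpace.expSeries_div_hasSum_exp ((r : ℝ) * c)).mul_left (Real.exp (-r))
    rw [← Real.exp_eq_exp_ℝ, ← Real.exp_add] at this
    convert! this using 2
    · rw [mul_pow]; ring
    · ring
  have hi : Integrable (fun n : ℕ => c ^ n) (poissonMeasure r) := by
    rw [integrable_poissonMeasure_iff]
    simpa [abs_of_nonneg hc] using hs.summable
  have hv := (hasSum_integral_poissonMeasure hi).unique (by simpa using hs)
  rw [← hv, ofReal_integral_eq_lintegral_ofReal hi (Eventually.of_forall fun n => by positivity)]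
  simp only [ENNReal.ofReal_pow hc]

/-- The counts of the level sets are independent Poisson variables, so the expectation is a product
of generating functions `exp ((c - 1) |{s = c}|)`. -/
theorem IsPoissonProcess.lintegral_map_prod {P : Measure Config} (hP : IsPoissonProcess P)
    (s : SimpleFunc unitInterval ℝ) (hs : ∀ x, 0 ≤ s x) :
    ∫⁻ ω : Config, ENNReal.ofReal (ω.map s).prod ∂P =
      ENNReal.ofReal (Real.exp (∫ x, s x - 1)) := by
  have hpos : ∀ c ∈ s.range, 0 ≤ c := by
    intro c hc
    obtain ⟨x, rfl⟩ := SimpleFunc.mem_range.1 hc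
    exact hs x
  have hexp : ∫ x, s x - 1 = ∑ c ∈ s.range, (c - 1) * volume.real (s ⁻¹' {c}) := by
    have hi : Integrable s (volume : Measure unitInterval) :=
      SimpleFunc.integrable_of_isFiniteMeasure s
    -- The level sets partition the interval, so the constant 1 can be distributed over them.
    have h1 : ∫ _ : unitInterval, (1 : ℝ) = ∑ c ∈ s.range, (volume : Measure unitInterval).real (s ⁻¹' {c}) := by
      rw [sum_measureReal_preimage_singleton _ fun c _ => s.measurableSet_fiber c,
        SimpleFunc.coe_range, Set.preimage_range]
      simp
    rw [integral_sub hi (integrable_const _), h1, ← SimpleFunc.integral_eq_integral s hi,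
      SimpleFunc.integral_eq, ← Finset.sum_sub_distrib]
    refine Finset.sum_congr rfl fun c _ => ?_
    rw [smul_eq_mul]
    ring
  set e := s.range.equivFin
  have hind := (hP.indep s.range.card (fun i => s ⁻¹' {(e.symm i : ℝ)})
    (fun i => s.measurableSet_fiber _) (fun i j hij => by
      refine Disjoint.preimage _ (Set.disjoint_singleton.2 fun h => hij ?_)
      exact e.symm.injective (Subtype.ext h))).comp
      (fun i n => ENNReal.ofReal (e.symm i : ℝ) ^ n) (fun i => measurable_from_top)
  have hprod := lintegral_prod_eq_prod_lintegral_of_indepFun Finset.univ _ hind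
    (fun i => measurable_from_top.comp (measurable_count (s.measurableSet_fiber _)))
  have hl : ∀ ω : Config, ENNReal.ofReal (ω.map s).prod =
      ∏ i, ENNReal.ofReal (e.symm i : ℝ) ^ count (s ⁻¹' {(e.symm i : ℝ)}) ω := by
    intro ω
    rw [map_prod_eq_prod_pow_count, ENNReal.ofReal_prod_of_nonneg
      (fun c hc => pow_nonneg (hpos c hc) _), ← Finset.prod_coe_sort, ← e.symm.prod_comp]
    exact Finset.prod_congr rfl fun i _ => ENNReal.ofReal_pow (hpos _ (e.symm i).2) _
  simp only [hl]
  refine hprod.trans ?_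
  rw [hexp, ← Finset.sum_coe_sort, ← e.symm.sum_comp, Real.exp_sum,
    ENNReal.ofReal_prod_of_nonneg (fun _ _ => (Real.exp_pos _).le)]
  refine Finset.prod_congr rfl fun i _ => ?_
  have hc := measurable_count (s.measurableSet_fiber (e.symm i : ℝ))
  have := lintegral_map (μ := P) (f := fun n : ℕ => ENNReal.ofReal (e.symm i : ℝ) ^ n)
    measurable_from_top hc
  rw [hP.law _ (s.measurableSet_fiber _), lintegral_pow_poissonMeasure _ (hpos _ (e.symm i).2)]
    at this
  exact this.symm

/-- The step function `exp (∑ A ∈ I, t A * 1_A)`. -/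
noncomputable def expStep (I : Finset {A : Set unitInterval // MeasurableSet A})
    (t : {A : Set unitInterval // MeasurableSet A} → ℝ) : SimpleFunc unitInterval ℝ :=
  (∑ A ∈ I, (SimpleFunc.const unitInterval (t A)).restrict (A : Set unitInterval)).map Real.exp

theorem expStep_apply (I : Finset {A : Set unitInterval // MeasurableSet A})
    (t : {A : Set unitInterval // MeasurableSet A} → ℝ) (x : unitInterval) :
    expStep I t x = Real.exp (∑ A ∈ I, t A * (A : Set unitInterval).indicator 1 x) := by
  classical
  rw [expStep, SimpleFunc.map_apply]
  congr 1
  induction I using Finset.induction with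
  | empty => simp
  | insert A I hA ih =>
    rw [Finset.sum_insert hA, Finset.sum_insert hA, SimpleFunc.coe_add, Pi.add_apply, ih,
      SimpleFunc.restrict_apply _ A.2]
    simp [Set.indicator_apply]

theorem expStep_pos (I : Finset {A : Set unitInterval // MeasurableSet A})
    (t : {A : Set unitInterval // MeasurableSet A} → ℝ) (x : unitInterval) : 0 < expStep I t x := by
  rw [expStep_apply]; positivity

/-- Counts are additive over points, so exponential moments of counts are expectations of product
functionals. -/
theorem exp_sum_mul_count (I : Finset {A : Set unitInterval // MeasurableSet A})
    (t : {A : Set unitInterval // MeasurableSet A} → ℝ) (ω : Config) :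
    Real.exp (∑ A ∈ I, t A * count A ω) = (ω.map (expStep I t)).prod := by
  induction ω using Multiset.induction with
  | empty => simp [count]
  | cons a ω ih =>
    rw [Multiset.map_cons, Multiset.prod_cons, ← ih, expStep_apply, ← Real.exp_add,
      ← Finset.sum_add_distrib]
    congr 1
    refine Finset.sum_congr rfl fun A _ => ?_
    rw [count_cons, Nat.cast_add, mul_add, add_comm]
    by_cases h : a ∈ (A : Set unitInterval) <;> simp [h]

/-- The counts generate the σ-algebra, and their exponential moments under both measures are `exp ∫
(g - 1)` with `g` a step function. -/
theorem IsPoissonProcess.eq_uniformMixture {P : Measure Config} [IsFiniteMeasure P]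
    (hP : IsPoissonProcess P) : P = uniformMixture := by
  have hl := fun I t => hP.lintegral_map_prod (expStep I t) fun x => (expStep_pos I t x).le
  have hnn : ∀ I t, 0 ≤ᵐ[P] fun ω : Config => (ω.map (expStep I t)).prod := fun I t =>
    Eventually.of_forall fun ω => by
      simp only [Pi.zero_apply, ← exp_sum_mul_count]; positivity
  have hm := fun I t => (measurable_map_prod (expStep I t).measurable).aestronglyMeasurable (μ := P)
  ext s hs
  refine measure_eq_of_integral_exp_eq (X := fun (A : {A : Set unitInterval // MeasurableSet A})
    (ω : Config) => (count A ω : ℝ)) (fun A => measurable_from_top.comp (measurable_count A.2))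
    (fun I t => ?_) (fun I t => ?_) (measurableSpace_config_le s hs)
  · simp only [exp_sum_mul_count]
    refine ⟨hm I t, ?_⟩
    rw [hasFiniteIntegral_iff_ofReal (hnn I t), hl]
    exact ENNReal.ofReal_lt_top
  · simp only [exp_sum_mul_count]
    rw [integral_eq_lintegral_of_nonneg_ae (hnn I t) (hm I t), hl,
      ENNReal.toReal_ofReal (Real.exp_pos _).le,
      (integrable_map_prod_and_integral (expStep I t).measurable
        (SimpleFunc.integrable_of_isFiniteMeasure _)).2]

/-! ### Exponential functionals of the Poisson process -/

theorem ae_uniformMixture_iff {p : Config → Prop} (hp : MeasurableSet {ω | p ω}) :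
    (∀ᵐ ω ∂uniformMixture, p ω) ↔ ∀ n, ∀ᵐ x : Fin n → unitInterval, p (toConfig x) := by
  rw [uniformMixture, Measure.ae_sum_iff]
  refine forall_congr' fun n => ?_
  rw [Measure.ae_ennreal_smul_measure_iff (by simp [sectorWeight_pos]),
    ae_map_iff (measurable_toConfig n).aemeasurable hp]

theorem ae_forall_comp_eval {n : ℕ} {p : unitInterval → Prop} (hp : ∀ᵐ x, p x) :
    ∀ᵐ x : Fin n → unitInterval, ∀ i, p (x i) :=
  ae_all_iff.2 fun i => (measurePreserving_eval (fun _ : Fin n => (volume : Measure unitInterval)) i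
    ).quasiMeasurePreserving.ae hp

/-- Almost every configuration avoids a given null set of points; hence product functionals of `L²`
classes do not depend on the representative. -/
theorem map_prod_ae_eq {f g : unitInterval → ℝ} (hf : Measurable f) (hg : Measurable g)
    (h : f =ᵐ[volume] g) :
    (fun ω : Config => (ω.map f).prod) =ᵐ[uniformMixture] fun ω => (ω.map g).prod := by
  refine (ae_uniformMixture_iff (measurableSet_eq_fun (measurable_map_prod hf)
    (measurable_map_prod hg))).2 fun n => ?_
  filter_upwards [ae_forall_comp_eval h] with x hx
  simp only [map_toConfig_prod, hx]

theorem measurable_coeFn (h : H) : Measurable h := (Lp.stronglyMeasurable h).measurable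

/-- The functional `∏_{x ∈ ω} (1 + h x) * exp (-∫ h)`. -/
noncomputable def poissonExpFun (h : H) (ω : Config) : ℝ :=
  (ω.map fun x => 1 + h x).prod * Real.exp (-∫ x, h x)

theorem measurable_poissonExpFun (h : H) : Measurable (poissonExpFun h) :=
  (measurable_map_prod ((measurable_coeFn h).const_add 1)).mul_const _

theorem integrable_coeFn (h : H) : Integrable h := (Lp.memLp h).integrable (by norm_num)

theorem integrable_mul_coeFn (h k : H) : Integrable (fun x => h x * k x) :=
  (Lp.memLp h).integrable_mul (Lp.memLp k)

theorem inner_eq_integral (h k : H) : inner ℝ h k = ∫ x, h x * k x := by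
  rw [L2.inner_def]
  simp [mul_comm]

/-- The product is the product functional of `(1 + h)(1 + k)`. As `(1 + h)(1 + k) - 1 = h + k + hk`,
the normalizations cancel the linear terms and leave `∫ hk`. -/
theorem integrable_poissonExpFun_mul_and_integral (h k : H) :
    Integrable (fun ω => poissonExpFun h ω * poissonExpFun k ω) uniformMixture ∧
      ∫ ω, poissonExpFun h ω * poissonExpFun k ω ∂uniformMixture = Real.exp (inner ℝ h k) := by
  have hm : Measurable fun x => (1 + h x) * (1 + k x) :=
    ((measurable_coeFn h).const_add 1).mul ((measurable_coeFn k).const_add 1)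
  have hi : Integrable fun x => (1 + h x) * (1 + k x) := by
    have := (((integrable_const (1 : ℝ)).add (integrable_coeFn h)).add (integrable_coeFn k)).add
      (integrable_mul_coeFn h k)
    refine this.congr (Eventually.of_forall fun x => ?_)
    simp only [Pi.add_apply]
    ring
  obtain ⟨h1, h2⟩ := integrable_map_prod_and_integral hm hi
  have he : (fun ω => poissonExpFun h ω * poissonExpFun k ω) = fun ω : Config =>
      (ω.map fun x => (1 + h x) * (1 + k x)).prod * Real.exp (-(∫ x, h x) - ∫ x, k x) := by
    ext ω
    rw [Multiset.prod_map_mul, poissonExpFun, poissonExpFun, sub_eq_add_neg, Real.exp_add]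
    ring
  rw [he]
  refine ⟨h1.mul_const _, ?_⟩
  rw [integral_mul_const, h2, ← Real.exp_add, inner_eq_integral]
  congr 1
  have : ∀ x, (1 + h x) * (1 + k x) - 1 = h x + k x + h x * k x := fun x => by ring
  have hadd : Integrable fun x => h x + k x := (integrable_coeFn h).add (integrable_coeFn k)
  simp only [this]
  rw [integral_add hadd (integrable_mul_coeFn h k),
    integral_add (integrable_coeFn h) (integrable_coeFn k)]
  ring

theorem memLp_poissonExpFun (h : H) : MemLp (poissonExpFun h) 2 uniformMixture := by
  rw [memLp_two_iff_integrable_sq (measurable_poissonExpFun h).aestronglyMeasurable]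
  simpa [sq] using (integrable_poissonExpFun_mul_and_integral h h).1

/-- The functional `∏_{x ∈ ω} (1 + h x) * exp (-∫ h)` as an element of `L²(π)`. -/
noncomputable def poissonExp (h : H) : Lp ℂ 2 uniformMixture :=
  ((memLp_poissonExpFun h).ofReal (K := ℂ)).toLp _

theorem coeFn_poissonExp (h : H) :
    poissonExp h =ᵐ[uniformMixture] fun ω => (poissonExpFun h ω : ℂ) :=
  MemLp.coeFn_toLp _

theorem inner_poissonExp (h k : H) :
    inner ℂ (poissonExp h) (poissonExp k) = (Real.exp (inner ℝ h k) : ℂ) := by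
  rw [L2.inner_def, ← (integrable_poissonExpFun_mul_and_integral h k).2, ← integral_complex_ofReal]
  refine integral_congr_ae ?_
  filter_upwards [coeFn_poissonExp h, coeFn_poissonExp k] with ω h1 h2
  simp [h1, h2, mul_comm]

theorem eq_zero_of_inner_poissonExp_eq_zero {F : Lp ℂ 2 uniformMixture}
    (hF : ∀ h, inner ℂ (poissonExp h) F = 0) : F = 0 := by
  rw [Lp.eq_zero_iff_ae_eq_zero]
  refine ae_eq_zero_of_integral_mul_cexp_eq_zero
    (X := fun (A : {A : Set unitInterval // MeasurableSet A}) (ω : Config) => (count A ω : ℝ))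
    (fun A => measurable_from_top.comp (measurable_count A.2)) (fun I t => ?_)
    (fun s hs => ⟨s, measurableSpace_config_le s hs, ae_eq_refl _⟩) (Lp.memLp F) fun I t => ?_
  · simp only [exp_sum_mul_count]
    rw [memLp_two_iff_integrable_sq
      (measurable_map_prod (expStep I t).measurable).aestronglyMeasurable]
    simp only [← Multiset.prod_map_pow]
    exact (integrable_map_prod_and_integral ((expStep I t).measurable.pow_const 2)
      (SimpleFunc.integrable_of_isFiniteMeasure ((expStep I t).map (· ^ 2)))).1
  -- With `1 + h = expStep I t`, the exponential of counts is a nonzero multiple of `poissonExp h`.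
  · have hm : MemLp (fun x => expStep I t x - 1) 2 (volume : Measure unitInterval) :=
      (SimpleFunc.memLp_of_isFiniteMeasure (expStep I t) 2 volume).sub (memLp_const 1)
    set h : H := hm.toLp _
    have h1 : (fun x => 1 + h x) =ᵐ[volume] expStep I t := by
      filter_upwards [hm.coeFn_toLp] with x hx
      rw [hx]; ring
    have h2 := map_prod_ae_eq ((measurable_coeFn h).const_add 1) (expStep I t).measurable h1
    have h3 := hF h
    rw [L2.inner_def] at h3
    have h4 : ∫ ω, (Real.exp (-∫ x, h x) : ℂ) *
        ((Real.exp (∑ A ∈ I, t A * count A ω) : ℂ) * F ω) ∂uniformMixture = 0 := by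
      rw [← h3]
      refine integral_congr_ae ?_
      filter_upwards [h2, coeFn_poissonExp h] with ω h5 h6
      rw [h6, poissonExpFun, h5, exp_sum_mul_count]
      simp only [RCLike.inner_apply, Complex.conj_ofReal]
      push_cast
      ring
    rw [integral_const_mul] at h4
    exact (mul_eq_zero.1 h4).resolve_left (by simp [Complex.exp_ne_zero])

/-! ### Hilbert space generalities -/

section Hilbert

variable {E : Type*} [NormedAddCommGroup E] [InnerProductSpace ℂ E]

/-- The map `J : x ↦ (Bᵢ x)ᵢ` is an isometry into the `ℓ²` sum, so `J* J = 1`; apply `J*` to the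
expansion of `J x` in its coordinates. -/
theorem hasSum_adjoint_apply_of_hasSum_norm_sq [CompleteSpace E] {ι : Type*} {F : ι → Type*}
    [∀ i, NormedAddCommGroup (F i)] [∀ i, InnerProductSpace ℂ (F i)] [∀ i, CompleteSpace (F i)]
    (B : ∀ i, E →L[ℂ] F i) (hB : ∀ x, HasSum (fun i => ‖B i x‖ ^ 2) (‖x‖ ^ 2)) (x : E) :
    HasSum (fun i => (B i).adjoint (B i x)) x := by
  classical
  let J₀ : E →ₗ[ℂ] lp F 2 :=
    { toFun := fun x => ⟨fun i => B i x, memℓp_gen (by simpa using (hB x).summable)⟩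
      map_add' := fun x y => lp.ext (funext fun i => map_add (B i) x y)
      map_smul' := fun c x => lp.ext (funext fun i => map_smul (B i) c x) }
  have hJ : ∀ x, ‖J₀ x‖ = ‖x‖ := fun x => by
    have h := lp.hasSum_norm (by norm_num : 0 < (2 : ℝ≥0∞).toReal) (J₀ x)
    simp only [ENNReal.toReal_ofNat, Real.rpow_ofNat] at h
    have h2 := h.unique (hB x)
    exact (pow_left_inj₀ (norm_nonneg _) (norm_nonneg _) two_ne_zero).1 h2
  let J : E →ₗᵢ[ℂ] lp F 2 := ⟨J₀, hJ⟩
  have h1 := (lp.hasSum_single (by norm_num) (J x)).mapL J.toContinuousLinearMap.adjoint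
  have h2 : J.toContinuousLinearMap.adjoint (J x) = x := by
    refine ext_inner_right ℂ fun y => ?_
    rw [ContinuousLinearMap.adjoint_inner_left]
    exact J.inner_map_map x y
  rw [h2] at h1
  convert! h1 using 2 with i
  refine ext_inner_right ℂ fun y => ?_
  rw [ContinuousLinearMap.adjoint_inner_left, ContinuousLinearMap.adjoint_inner_left,
    lp.inner_single_left]
  rfl

theorem hasSum_smul_adjoint_apply_of_hasSum_norm_sq [CompleteSpace E] {ι : Type*} {F : ι → Type*}
    [∀ i, NormedAddCommGroup (F i)] [∀ i, InnerProductSpace ℂ (F i)] [∀ i, CompleteSpace (F i)]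
    {c : ι → ℝ} (hc : ∀ i, 0 ≤ c i) (B : ∀ i, E →L[ℂ] F i)
    (hB : ∀ x, HasSum (fun i => c i * ‖B i x‖ ^ 2) (‖x‖ ^ 2)) (x : E) :
    HasSum (fun i => (c i : ℂ) • (B i).adjoint (B i x)) x := by
  have h := hasSum_adjoint_apply_of_hasSum_norm_sq (fun i => (Real.sqrt (c i) : ℂ) • B i)
    (fun x => by
      convert! hB x using 2 with i
      simp [norm_smul, mul_pow, abs_of_nonneg (Real.sqrt_nonneg _), Real.sq_sqrt (hc i)]) x
  convert! h using 2 with i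
  rw [map_smulₛₗ]
  simp only [smul_apply, map_smul, smul_smul, Complex.conj_ofReal]
  rw [← Complex.ofReal_mul, Real.mul_self_sqrt (hc i)]

variable {ι : Type*}

theorem inner_linearCombination (v : ι → E) (S T : ι →₀ ℂ) :
    inner ℂ (Finsupp.linearCombination ℂ v S) (Finsupp.linearCombination ℂ v T) =
      S.sum fun i a => T.sum fun j b => starRingEnd ℂ a * (b * inner ℂ (v i) (v j)) := by
  simp only [Finsupp.linearCombination_apply, Finsupp.sum, sum_inner, inner_sum, inner_smul_left,
    inner_smul_right, Finset.mul_sum]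
  rw [Finset.sum_comm]
  exact Finset.sum_congr rfl fun i _ => Finset.sum_congr rfl fun j _ => mul_left_comm _ _ _

theorem denseRange_linearCombination [CompleteSpace E] {v : ι → E}
    (hv : ∀ x, (∀ i, inner ℂ (v i) x = 0) → x = 0) :
    DenseRange (Finsupp.linearCombination ℂ v) := by
  have : Dense ((Submodule.span ℂ (Set.range v) : Submodule ℂ E) : Set E) := by
    rw [Submodule.dense_iff_topologicalClosure_eq_top, Submodule.topologicalClosure_eq_top_iff,
      Submodule.eq_bot_iff]
    intro x hx
    exact hv x fun i => hx _ (Submodule.subset_span ⟨i, rfl⟩)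
  rwa [← Finsupp.range_linearCombination] at this

/-- Two total families of vectors with the same Gram matrix are related by a unitary operator. -/
theorem exists_linearIsometryEquiv_of_inner_eq {F : Type*} [NormedAddCommGroup F]
    [InnerProductSpace ℂ F] [CompleteSpace E] [CompleteSpace F] {v : ι → E} {w : ι → F}
    (hv : ∀ x, (∀ i, inner ℂ (v i) x = 0) → x = 0) (hw : ∀ x, (∀ i, inner ℂ (w i) x = 0) → x = 0)
    (h : ∀ i j, inner ℂ (v i) (v j) = inner ℂ (w i) (w j)) :
    ∃ U : E ≃ₗᵢ[ℂ] F, ∀ i, U (v i) = w i := by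
  have hn : ∀ T : ι →₀ ℂ, ‖Finsupp.linearCombination ℂ w T‖ = ‖Finsupp.linearCombination ℂ v T‖ := by
    intro T
    rw [@norm_eq_sqrt_re_inner ℂ, @norm_eq_sqrt_re_inner ℂ, inner_linearCombination,
      inner_linearCombination]
    simp only [h]
  refine ⟨(LinearEquiv.refl ℂ (ι →₀ ℂ)).extendOfIsometry (Finsupp.linearCombination ℂ v)
    (Finsupp.linearCombination ℂ w) (denseRange_linearCombination hv)
    (denseRange_linearCombination hw) hn, fun i => ?_⟩
  have := (LinearEquiv.refl ℂ (ι →₀ ℂ)).extendOfIsometry_eq (e₁ := Finsupp.linearCombination ℂ v)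
    (e₂ := Finsupp.linearCombination ℂ w) (denseRange_linearCombination hv)
    (denseRange_linearCombination hw) hn (Finsupp.single i 1)
  simpa using this

theorem ext_of_forall_inner_eq {v : ι → E}
    (hv : ∀ x, (∀ i, inner ℂ (v i) x = 0) → x = 0) {x y : E}
    (h : ∀ i, inner ℂ (v i) x = inner ℂ (v i) y) : x = y :=
  sub_eq_zero.1 (hv _ fun i => by rw [inner_sub_right, h, sub_self])

theorem coeFn_linearCombination {α : Type*} [MeasurableSpace α] {ν : Measure α}
    {v : ι → Lp ℂ 2 ν} {g : ι → α → ℂ} (hv : ∀ i, v i =ᵐ[ν] g i) (T : ι →₀ ℂ) :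
    Finsupp.linearCombination ℂ v T =ᵐ[ν] fun x => T.sum fun i c => c * g i x := by
  induction T using Finsupp.induction_linear with
  | zero =>
    simp only [map_zero, Finsupp.sum_zero_index]
    exact Lp.coeFn_zero ℂ 2 ν
  | add S T hS hT =>
    rw [map_add]
    filter_upwards [Lp.coeFn_add (Finsupp.linearCombination ℂ v S)
      (Finsupp.linearCombination ℂ v T), hS, hT] with x h1 h2 h3
    rw [h1, Pi.add_apply, h2, h3, Finsupp.sum_add_index' (by simp) (by intros; ring)]
  | single i c =>
    rw [Finsupp.linearCombination_single]
    filter_upwards [Lp.coeFn_smul c (v i), hv i] with x h1 h2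
    simp [h1, h2]

end Hilbert

/-! ### Products on `[0,1]ⁿ` -/

variable {n : ℕ}

theorem memLp_prod (f : Fin n → H) :
    MemLp (fun x : Fin n → unitInterval => ∏ i, (f i (x i) : ℂ)) 2 volume := by
  have hm : Measurable fun x : Fin n → unitInterval => ∏ i, (f i (x i) : ℂ) :=
    Finset.measurable_prod _ fun i _ => Complex.measurable_ofReal.comp
      ((measurable_coeFn (f i)).comp (measurable_pi_apply i))
  rw [memLp_two_iff_integrable_sq_norm hm.aestronglyMeasurable]
  simp only [norm_prod, ← Finset.prod_pow]
  refine Integrable.fintype_prod (f := fun i x => ‖(f i x : ℂ)‖ ^ 2) fun i => ?_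
  simpa using (Lp.memLp (f i)).integrable_sq

/-- The product `f₁ ⊗ ⋯ ⊗ fₙ` in `L²([0,1]ⁿ)`. -/
noncomputable def prodLp (f : Fin n → H) : Lp ℂ 2 (volume : Measure (Fin n → unitInterval)) :=
  (memLp_prod f).toLp _

theorem coeFn_prodLp (f : Fin n → H) :
    prodLp f =ᵐ[volume] fun x => ∏ i, (f i (x i) : ℂ) := MemLp.coeFn_toLp _

theorem eq_zero_of_inner_prodLp_eq_zero {u : Lp ℂ 2 (volume : Measure (Fin n → unitInterval))}
    (hu : ∀ f, inner ℂ (prodLp f) u = 0) : u = 0 := by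
  have hexp : ∀ (I : Finset (Fin n)) (t : Fin n → ℝ), ∃ f : Fin n → H,
      prodLp f =ᵐ[volume] fun x => (Real.exp (∑ i ∈ I, t i * (x i : ℝ)) : ℂ) := by
    -- Exponentials of linear forms are themselves products: coordinates in `I` carry `exp (tᵢ y)`,
    -- the others the constant 1.
    intro I t
    have hm : ∀ i, MemLp (fun y : unitInterval => Real.exp (if i ∈ I then t i * (y : ℝ) else 0)) 2
        volume := fun i => by
      refine Continuous.memLp_of_hasCompactSupport ?_ (HasCompactSupport.of_compactSpace _)
      split_ifs <;> fun_prop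
    refine ⟨fun i => (hm i).toLp _, (coeFn_prodLp _).trans ?_⟩
    have hall : ∀ᵐ x : Fin n → unitInterval, ∀ i, (hm i).toLp _ (x i) =
        Real.exp (if i ∈ I then t i * (x i : ℝ) else 0) := ae_all_iff.2 fun i =>
      (measurePreserving_eval (fun _ : Fin n => (volume : Measure unitInterval)) i
        ).quasiMeasurePreserving.ae (hm i).coeFn_toLp
    filter_upwards [hall] with x hx
    simp only [hx]
    rw [← Complex.ofReal_prod, ← Real.exp_sum, Finset.sum_ite_mem, Finset.univ_inter]
  rw [Lp.eq_zero_iff_ae_eq_zero]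
  refine ae_eq_zero_of_integral_mul_cexp_eq_zero
    (X := fun (i : Fin n) (x : Fin n → unitInterval) => (x i : ℝ)) (fun i => by fun_prop)
    (fun I t => ?_) (fun s hs => ⟨s, ?_, ae_eq_refl _⟩) (Lp.memLp u) fun I t => ?_
  · refine Continuous.memLp_of_hasCompactSupport ?_ (HasCompactSupport.of_compactSpace _)
    fun_prop
  · have : (⨆ i, MeasurableSpace.comap (fun x : Fin n → unitInterval => (x i : ℝ)) inferInstance) =
        (inferInstance : MeasurableSpace (Fin n → unitInterval)) := by
      simp only [MeasurableSpace.pi, Subtype.instMeasurableSpace, MeasurableSpace.comap_comp]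
      rfl
    rwa [this]
  · obtain ⟨f, hf⟩ := hexp I t
    rw [← hu f, L2.inner_def]
    refine integral_congr_ae ?_
    filter_upwards [hf] with x hx
    rw [hx]
    simp only [RCLike.inner_apply, Complex.conj_ofReal]
    ring

/-! ### Restriction of functionals to configurations of `n` points -/

/-- Every sector has positive weight, so almost sure statements about configurations restrict to
each sector. -/
theorem quasiMeasurePreserving_toConfig (n : ℕ) :
    Measure.QuasiMeasurePreserving (toConfig : (Fin n → unitInterval) → Config) volume
      uniformMixture := by
  refine ⟨measurable_toConfig n, ?_⟩
  refine (Measure.absolutelyContinuous_smul (c := ENNReal.ofReal (sectorWeight n))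
    (by simp [sectorWeight_pos])).trans ?_
  exact (Measure.le_sum (fun n => ENNReal.ofReal (sectorWeight n) •
    (volume : Measure (Fin n → unitInterval)).map toConfig) n).absolutelyContinuous

theorem hasSum_sectorWeight_mul_integral_norm_sq (F : Lp ℂ 2 uniformMixture) :
    HasSum (fun n => sectorWeight n * ∫ x : Fin n → unitInterval, ‖F (toConfig x)‖ ^ 2)
      (‖F‖ ^ 2) := by
  have h := hasSum_integral_uniformMixture ((memLp_two_iff_integrable_sq_norm
    (Lp.aestronglyMeasurable F)).1 (Lp.memLp F))
  convert! h using 1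
  rw [← @inner_self_eq_norm_sq ℂ, L2.inner_def, ← integral_re (L2.integrable_inner F F)]
  simp [inner_self_eq_norm_sq_to_K, ← Complex.ofReal_pow]

theorem memLp_comp_toConfig (n : ℕ) (F : Lp ℂ 2 uniformMixture) :
    MemLp (fun x : Fin n → unitInterval => F (toConfig x)) 2 volume := by
  refine MemLp.comp_of_map ?_ (measurable_toConfig n).aemeasurable
  refine (Lp.memLp F).of_measure_le_smul
    (c := (ENNReal.ofReal (sectorWeight n))⁻¹) (by simp [sectorWeight_pos]) ?_
  have := Measure.le_sum (fun n => ENNReal.ofReal (sectorWeight n) •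
    (volume : Measure (Fin n → unitInterval)).map toConfig) n
  intro s
  have h1 := this s
  simp only [Measure.smul_apply, smul_eq_mul] at h1 ⊢
  rw [mul_comm, ← div_eq_mul_inv, ENNReal.le_div_iff_mul_le (by simp [sectorWeight_pos]) (by simp),
    mul_comm]
  exact h1

theorem norm_sq_toLp {α : Type*} [MeasurableSpace α] {ν : Measure α} {f : α → ℂ}
    (hf : MemLp f 2 ν) : ‖hf.toLp f‖ ^ 2 = ∫ x, ‖f x‖ ^ 2 ∂ν := by
  rw [← @inner_self_eq_norm_sq ℂ, L2.inner_def, ← integral_re (L2.integrable_inner _ _)]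
  refine integral_congr_ae ?_
  filter_upwards [hf.coeFn_toLp] with x hx
  simp [hx, inner_self_eq_norm_sq_to_K, ← Complex.ofReal_pow]

/-- The restriction of a functional of the Poisson process to configurations of `n` points. -/
noncomputable def sector (n : ℕ) :
    Lp ℂ 2 uniformMixture →L[ℂ] Lp ℂ 2 (volume : Measure (Fin n → unitInterval)) :=
  LinearMap.mkContinuous
    { toFun := fun F => (memLp_comp_toConfig n F).toLp _
      map_add' := fun F G => by
        rw [← MemLp.toLp_add]
        exact MemLp.toLp_congr _ _ ((quasiMeasurePreserving_toConfig n).ae (Lp.coeFn_add F G))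
      map_smul' := fun c F => by
        rw [RingHom.id_apply, ← MemLp.toLp_const_smul]
        exact MemLp.toLp_congr _ _ ((quasiMeasurePreserving_toConfig n).ae (Lp.coeFn_smul c F)) }
    -- The bound: `sectorWeight n` times the squared norm of the restriction is one term of the
    -- series for `‖F‖²`.
    (Real.sqrt (sectorWeight n)⁻¹) fun F => by
      refine abs_le_of_sq_le_sq' ?_ (by positivity) |>.2
      rw [mul_pow, Real.sq_sqrt (inv_nonneg.2 (sectorWeight_pos n).le), LinearMap.coe_mk,
        AddHom.coe_mk, norm_sq_toLp, inv_mul_eq_div, le_div_iff₀ (sectorWeight_pos n), mul_comm]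
      exact le_hasSum (hasSum_sectorWeight_mul_integral_norm_sq F) n fun m _ =>
        mul_nonneg (sectorWeight_pos m).le (integral_nonneg fun _ => by positivity)

theorem coeFn_sector (n : ℕ) (F : Lp ℂ 2 uniformMixture) :
    sector n F =ᵐ[volume] fun x => F (toConfig x) := (memLp_comp_toConfig n F).coeFn_toLp

theorem hasSum_sectorWeight_smul_adjoint_sector (F : Lp ℂ 2 uniformMixture) :
    HasSum (fun n => (sectorWeight n : ℂ) • (sector n).adjoint (sector n F)) F := by
  refine hasSum_smul_adjoint_apply_of_hasSum_norm_sq (fun n => (sectorWeight_pos n).le) sector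
    (fun F => ?_) F
  convert! hasSum_sectorWeight_mul_integral_norm_sq F using 3 with n
  exact norm_sq_toLp (memLp_comp_toConfig n F)

theorem inner_poissonExp_adjoint_sector (k : H) (f : Fin n → H) :
    inner ℂ (poissonExp k) ((sector n).adjoint (prodLp f)) =
      ((Real.exp (-∫ x, k x) * ∏ i, ∫ x, (1 + k x) * f i x : ℝ) : ℂ) := by
  rw [ContinuousLinearMap.adjoint_inner_right, L2.inner_def,
    ← integral_fintype_prod_volume_eq_prod (fun i x => (1 + k x) * f i x), ← integral_const_mul,
    ← integral_complex_ofReal]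
  refine integral_congr_ae ?_
  filter_upwards [coeFn_sector n (poissonExp k), coeFn_prodLp f,
    (quasiMeasurePreserving_toConfig n).ae (coeFn_poissonExp k)] with x h1 h2 h3
  rw [h1, h2, h3, poissonExpFun, map_toConfig_prod]
  simp only [RCLike.inner_apply, Complex.conj_ofReal, Finset.prod_mul_distrib]
  push_cast
  ring

/-! ### Sums over set partitions -/

section Partitions

variable {ι R : Type*} [DecidableEq ι] [CommRing R]

/-- The sum over all partitions of `s` of the products of the weights of the blocks. -/
def partitionSum (w : Finset ι → R) (s : Finset ι) : R :=
  ∑ Q : Finpartition s, ∏ B ∈ Q.parts, w B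

theorem partitionSum_empty (w : Finset ι → R) : partitionSum w ∅ = 1 := by
  have : Unique (Finpartition (∅ : Finset ι)) :=
    inferInstanceAs (Unique (Finpartition (⊥ : Finset ι)))
  have h : ∀ Q : Finpartition (∅ : Finset ι), Q.parts = ∅ := fun Q => Q.parts_eq_empty_iff.2 rfl
  simp only [partitionSum, h, Finset.prod_empty]
  rw [Finset.sum_const, Finset.card_univ, Fintype.card_unique, one_smul]

/-- Deleting the block `B` is a bijection onto the partitions of `s \ B`. -/
theorem sum_filter_part_eq (w : Finset ι → R) {s B : Finset ι} {a : ι} (ha : a ∈ B) (hB : B ⊆ s) :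
    ∑ Q : Finpartition s with Q.part a = B, ∏ D ∈ Q.parts, w D = w B * partitionSum w (s \ B) := by
  have hB0 : B ≠ ⊥ := Finset.ne_empty_of_mem ha
  have hd : Disjoint (s \ B) B := Finset.sdiff_disjoint
  have hs : (s \ B) ⊔ B = s := Finset.sdiff_union_of_subset hB
  rw [partitionSum, Finset.mul_sum]
  symm
  refine Finset.sum_bij (fun Q _ => Q.extend hB0 hd hs) (fun Q _ => ?_) (fun Q _ Q' _ h => ?_)
    (fun Q hQ => ?_) (fun Q _ => ?_)
  · rw [Finset.mem_filter_univ]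
    exact Finpartition.part_eq_of_mem _ (Finset.mem_insert_self _ _) ha
  · have hn : ∀ Q : Finpartition (s \ B), B ∉ Q.parts := fun Q hQ =>
      (Finset.mem_sdiff.1 (Q.le hQ ha)).2 ha
    have h' : insert B Q.parts = insert B Q'.parts := congrArg Finpartition.parts h
    ext1
    rw [← Finset.erase_insert (hn Q), h', Finset.erase_insert (hn Q')]
  · rw [Finset.mem_filter_univ] at hQ
    have hmem : B ∈ Q.parts := hQ ▸ Q.part_mem.2 (hB ha)
    refine ⟨Q.ofSubset (parts := Q.parts.erase B) (Finset.erase_subset _ _) ?_,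
      Finset.mem_univ _, ?_⟩
    · ext x
      rw [Finset.mem_sup, Finset.mem_sdiff]
      constructor
      · rintro ⟨D, hD, hx⟩
        rw [Finset.mem_erase] at hD
        exact ⟨Q.le hD.2 hx, fun hxB => hD.1 (Q.eq_of_mem_parts hD.2 hmem hx hxB)⟩
      · rintro ⟨hx, hxB⟩
        refine ⟨Q.part x, Finset.mem_erase.2 ⟨?_, Q.part_mem.2 hx⟩, Q.mem_part hx⟩
        rintro rfl
        exact hxB (Q.mem_part hx)
    · ext1
      exact Finset.insert_erase hmem
  · refine (Finset.prod_insert fun hQ => ?_).symm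
    exact (Finset.mem_sdiff.1 (Q.le hQ ha)).2 ha

theorem partitionSum_insert (w : Finset ι → R) {s : Finset ι} {a : ι} (ha : a ∉ s) :
    partitionSum w (insert a s) = ∑ D ∈ s.powerset, w (insert a D) * partitionSum w (s \ D) := by
  have hmap : ∀ Q ∈ (Finset.univ : Finset (Finpartition (insert a s))),
      Q.part a ∈ s.powerset.image (insert a) := by
    intro Q _
    refine Finset.mem_image.2 ⟨(Q.part a).erase a, ?_, Finset.insert_erase
      (Q.mem_part (Finset.mem_insert_self a s))⟩
    rw [Finset.mem_powerset]
    exact (Finset.erase_subset_erase a (Q.part_subset a)).trans (Finset.erase_insert_subset a s)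
  rw [partitionSum, ← Finset.sum_fiberwise_of_maps_to hmap, Finset.sum_image]
  · refine Finset.sum_congr rfl fun D hD => ?_
    rw [Finset.mem_powerset] at hD
    rw [sum_filter_part_eq w (Finset.mem_insert_self a D) (Finset.insert_subset_insert a hD)]
    congr 2
    ext x
    simp only [Finset.mem_sdiff, Finset.mem_insert]
    constructor
    · rintro ⟨rfl | h1, h2⟩
      · simp at h2
      · exact ⟨h1, fun h => h2 (Or.inr h)⟩
    · rintro ⟨h1, h2⟩
      exact ⟨Or.inr h1, by rintro (rfl | h); exacts [ha h1, h2 h]⟩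
  · intro D hD D' hD' h
    rw [Finset.mem_coe, Finset.mem_powerset] at hD hD'
    rw [← Finset.erase_insert fun h => ha (hD h), h, Finset.erase_insert fun h => ha (hD' h)]

/-- The weights of blocks for partitions into points `i`, with weight `y i`, and pairs `B`, with
weight `-d B`. -/
def pairWeight (y : ι → R) (d : Finset ι → R) (B : Finset ι) : R :=
  if B.card = 1 then ∏ i ∈ B, y i else if B.card = 2 then -d B else 0

/-- The Hermite (Wick) recursion: `a` is alone or paired with some `b`, larger blocks having weight
0. -/
theorem partitionSum_pairWeight_insert (y : ι → R) (d : Finset ι → R) {s : Finset ι} {a : ι}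
    (ha : a ∉ s) :
    partitionSum (pairWeight y d) (insert a s) = y a * partitionSum (pairWeight y d) s -
      ∑ b ∈ s, d {a, b} * partitionSum (pairWeight y d) (s.erase b) := by
  rw [partitionSum_insert _ ha, ← Finset.sum_subset
    (s₁ := insert ∅ (s.image fun b => ({b} : Finset ι)))]
  · rw [Finset.sum_insert (by simp), Finset.sum_image (by simp), sub_eq_add_neg,
      ← Finset.sum_neg_distrib]
    congr 1
    · simp [pairWeight]
    · refine Finset.sum_congr rfl fun b hb => ?_
      have : ({a, b} : Finset ι).card = 2 := Finset.card_pair fun h => ha (h ▸ hb)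
      rw [pairWeight, if_neg (by omega), if_pos this, Finset.sdiff_singleton_eq_erase, neg_mul]
  · intro D hD
    rw [Finset.mem_insert, Finset.mem_image] at hD
    rw [Finset.mem_powerset]
    rcases hD with rfl | ⟨b, hb, rfl⟩
    · simp
    · simpa using hb
  · intro D hD hD'
    rw [Finset.mem_powerset] at hD
    have hc : 2 ≤ D.card := by
      by_contra! hlt
      apply hD'
      rw [Finset.mem_insert, Finset.mem_image]
      have : D.card = 0 ∨ D.card = 1 := by omega
      rcases this with h | h
      · exact Or.inl (Finset.card_eq_zero.1 h)
      · obtain ⟨b, rfl⟩ := Finset.card_eq_one.1 h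
        exact Or.inr ⟨b, by simpa using hD, rfl⟩
    have : (insert a D).card = D.card + 1 := Finset.card_insert_of_notMem fun h => ha (hD h)
    rw [pairWeight, if_neg (by omega), if_neg (by omega), zero_mul]

/-- Partitions with a larger block contribute 0 on the right, so the restriction on block sizes
moves into the weights, where the recursion applies. -/
theorem sum_partitionsLeTwo_eq {n : ℕ} (y : Fin n → R) (d : Finset (Fin n) → R) :
    ∑ Q ∈ partitionsLeTwo n, (-1) ^ (pairs Q).card * (∏ z ∈ singletons Q, y z) *
      ∏ B ∈ pairs Q, d B = partitionSum (pairWeight y d) Finset.univ := by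
  rw [partitionSum, partitionsLeTwo, Finset.sum_filter]
  refine Finset.sum_congr rfl fun Q _ => ?_
  split_ifs with hQ
  · rw [← Finset.prod_filter_mul_prod_filter_not Q.parts fun B => B.card = 2, mul_right_comm,
      ← Finset.prod_const, pairs, ← Finset.prod_mul_distrib]
    congr 1
    · refine Finset.prod_congr rfl fun B hB => ?_
      rw [Finset.mem_filter] at hB
      rw [pairWeight, if_neg (by omega), if_pos hB.2, neg_one_mul]
    · refine Finset.prod_bij (fun z _ => {z}) (fun z hz => ?_) (fun z _ z' _ h => ?_)
        (fun B hB => ?_) (fun z _ => ?_)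
      · rw [singletons, Finset.mem_filter_univ] at hz
        rw [Finset.mem_filter]
        exact ⟨hz, by simp⟩
      · exact Finset.singleton_injective h
      · rw [Finset.mem_filter] at hB
        have h1 := hQ B hB.1
        have h2 : 0 < B.card := Finset.card_pos.2 (Q.nonempty_of_mem_parts hB.1)
        obtain ⟨z, rfl⟩ := Finset.card_eq_one.1 (show B.card = 1 by have := hB.2; omega)
        exact ⟨z, by simpa [singletons] using hB.1, rfl⟩
      · simp [pairWeight]
  · push Not at hQ
    obtain ⟨B, hB, hB2⟩ := hQ
    rw [Finset.prod_eq_zero hB]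
    rw [pairWeight, if_neg (by omega), if_neg (by omega)]

end Partitions

/-! ### Random variables with moments of all orders -/

section AllMoments

variable {Ω : Type*} [MeasurableSpace Ω] {μ : Measure Ω}

/-- `g` has finite absolute moments of all orders. -/
def HasAllMoments (g : Ω → ℝ) (μ : Measure Ω) : Prop := ∀ p : ℝ≥0, MemLp g p μ

theorem HasAllMoments.memLp_two {g : Ω → ℝ} (hg : HasAllMoments g μ) : MemLp g 2 μ := by
  simpa using hg 2

theorem HasAllMoments.integrable {g : Ω → ℝ} (hg : HasAllMoments g μ) : Integrable g μ :=
  memLp_one_iff_integrable.1 (by simpa using hg 1)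

theorem HasAllMoments.const [IsFiniteMeasure μ] (c : ℝ) : HasAllMoments (fun _ : Ω => c) μ :=
  fun _ => memLp_const c

theorem HasAllMoments.add {f g : Ω → ℝ} (hf : HasAllMoments f μ) (hg : HasAllMoments g μ) :
    HasAllMoments (fun x => f x + g x) μ := fun p => (hf p).add (hg p)

theorem HasAllMoments.neg {f : Ω → ℝ} (hf : HasAllMoments f μ) :
    HasAllMoments (fun x => -f x) μ := fun p => (hf p).neg

theorem HasAllMoments.abs {f : Ω → ℝ} (hf : HasAllMoments f μ) :
    HasAllMoments (fun x => |f x|) μ := fun p => (hf p).abs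

/-- Hölder with exponents `2p`, `2p`; closure under products is why moments of all orders are
tracked. -/
theorem HasAllMoments.mul {f g : Ω → ℝ} (hf : HasAllMoments f μ) (hg : HasAllMoments g μ) :
    HasAllMoments (fun x => f x * g x) μ := by
  intro p
  have : ENNReal.HolderTriple ((2 * p : ℝ≥0) : ℝ≥0∞) ((2 * p : ℝ≥0) : ℝ≥0∞) (p : ℝ≥0∞) := by
    refine ⟨?_⟩
    rw [ENNReal.coe_mul, ENNReal.mul_inv (by simp) (by simp), ← add_mul]
    simp [ENNReal.inv_two_add_inv_two]
  exact (hg (2 * p)).mul (hf (2 * p))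

theorem HasAllMoments.sum [IsFiniteMeasure μ] {ι : Type*} {s : Finset ι} {f : ι → Ω → ℝ}
    (hf : ∀ i ∈ s, HasAllMoments (f i) μ) : HasAllMoments (fun x => ∑ i ∈ s, f i x) μ :=
  fun p => memLp_finsetSum s fun i hi => hf i hi p

theorem HasAllMoments.prod [IsFiniteMeasure μ] {ι : Type*} {s : Finset ι} {f : ι → Ω → ℝ}
    (hf : ∀ i ∈ s, HasAllMoments (f i) μ) : HasAllMoments (fun x => ∏ i ∈ s, f i x) μ := by
  classical
  induction s using Finset.induction with
  | empty => simpa using HasAllMoments.const 1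
  | insert a s ha ih =>
    simp only [Finset.prod_insert ha]
    exact (hf a (Finset.mem_insert_self a s)).mul
      (ih fun i hi => hf i (Finset.mem_insert_of_mem hi))

theorem HasAllMoments.exp {f : Ω → ℝ} (hm : AEMeasurable f μ)
    (hf : ∀ t, Integrable (fun x => Real.exp (t * f x)) μ) :
    HasAllMoments (fun x => Real.exp (f x)) μ := by
  intro p
  rcases eq_or_ne p 0 with rfl | hp
  · simpa using (hm.exp).aestronglyMeasurable
  · rw [← integrable_norm_rpow_iff hm.exp.aestronglyMeasurable (by simpa using hp) (by simp)]
    refine (hf p).congr (Eventually.of_forall fun x => ?_)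
    simp only [Real.norm_eq_abs, Real.abs_exp, ENNReal.coe_toReal]
    rw [← Real.exp_mul, mul_comm]

end AllMoments

/-! ### White noise -/

namespace IsWhiteNoise

variable {Ω : Type*} [MeasurableSpace Ω] {μ : Measure Ω} {W : H → Ω → ℝ}

theorem smul_ae_eq (hW : IsWhiteNoise μ W) (t : ℝ) (h : H) :
    W (t • h) =ᵐ[μ] fun η => t * W h η := by
  simpa using hW.linear t 0 h 0

theorem add_ae_eq (hW : IsWhiteNoise μ W) (h k : H) :
    W (h + k) =ᵐ[μ] fun η => W h η + W k η := by
  simpa using hW.linear 1 1 h k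

theorem sub_ae_eq (hW : IsWhiteNoise μ W) (h k : H) :
    W (h - k) =ᵐ[μ] fun η => W h η - W k η := by
  simpa [sub_eq_add_neg] using hW.linear 1 (-1) h k

theorem sum_ae_eq (hW : IsWhiteNoise μ W) (I : Finset H) (t : H → ℝ) :
    W (∑ h ∈ I, t h • h) =ᵐ[μ] fun η => ∑ h ∈ I, t h * W h η := by
  classical
  induction I using Finset.induction with
  | empty => simpa using hW.linear 0 0 0 0
  | insert a I ha ih =>
    simp only [Finset.sum_insert ha]
    filter_upwards [hW.add_ae_eq (t a • a) (∑ h ∈ I, t h • h), hW.smul_ae_eq (t a) a, ih]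
      with η h1 h2 h3
    rw [h1, h2, h3]

variable [IsProbabilityMeasure μ]

theorem map_eq_gaussianReal (hW : IsWhiteNoise μ W) (h : H) :
    μ.map (W h) = gaussianReal 0 (‖h‖₊ ^ 2) := by
  have : IsProbabilityMeasure (μ.map (W h)) :=
    Measure.isProbabilityMeasure_map (hW.measurable h).aemeasurable
  refine Measure.ext_of_charFun (funext fun t => ?_)
  rw [charFun_gaussianReal, charFun_apply_real,
    integral_map (hW.measurable h).aemeasurable (by fun_prop)]
  have h1 : ∫ η, Complex.exp (t * W h η * Complex.I) ∂μ =
      ∫ η, Complex.exp (Complex.I * (W (t • h) η : ℂ)) ∂μ := by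
    refine integral_congr_ae ?_
    filter_upwards [hW.smul_ae_eq t h] with η hη
    rw [hη]
    push_cast
    ring_nf
  rw [h1, hW.charFunctional, norm_smul]
  congr 1
  push_cast
  rw [mul_pow, ← Complex.ofReal_pow, Real.norm_eq_abs, sq_abs]
  simp
  ring

theorem integrable_exp_mul (hW : IsWhiteNoise μ W) (h : H) (t : ℝ) :
    Integrable (fun η => Real.exp (t * W h η)) μ := by
  have := integrable_exp_mul_gaussianReal (μ := 0) (v := ‖h‖₊ ^ 2) t
  rw [← hW.map_eq_gaussianReal h] at this
  exact this.comp_measurable (hW.measurable h)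

theorem integral_exp (hW : IsWhiteNoise μ W) (h : H) :
    ∫ η, Real.exp (W h η) ∂μ = Real.exp (‖h‖ ^ 2 / 2) := by
  have := mgf_gaussianReal (hW.map_eq_gaussianReal h) 1
  simpa [mgf] using this

theorem hasAllMoments_exp (hW : IsWhiteNoise μ W) (h : H) :
    HasAllMoments (fun η => Real.exp (W h η)) μ :=
  HasAllMoments.exp (hW.measurable h).aemeasurable (hW.integrable_exp_mul h)

theorem hasAllMoments (hW : IsWhiteNoise μ W) (h : H) : HasAllMoments (W h) μ := by
  intro p
  have := memLp_id_gaussianReal (μ := 0) (v := ‖h‖₊ ^ 2) p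
  rw [← hW.map_eq_gaussianReal h] at this
  exact this.comp_of_map (hW.measurable h).aemeasurable

/-- Moving `k` in the direction `f` brings down a factor `W f`: multiplication by noise becomes
differentiation of the transform in `k`. -/
theorem hasDerivAt_integral_exp_mul (hW : IsWhiteNoise μ W) (k f : H) {g : Ω → ℝ}
    (hg : HasAllMoments g μ) :
    HasDerivAt (fun t : ℝ => ∫ η, Real.exp (W (k + t • f) η) * g η ∂μ)
      (∫ η, Real.exp (W k η) * (W f η * g η) ∂μ) 0 := by
  have hlin : (fun t : ℝ => ∫ η, Real.exp (W (k + t • f) η) * g η ∂μ) =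
      fun t : ℝ => ∫ η, Real.exp (W k η + t * W f η) * g η ∂μ := by
    ext t
    refine integral_congr_ae ?_
    filter_upwards [hW.add_ae_eq k (t • f), hW.smul_ae_eq t f] with η h1 h2
    rw [h1, h2]
  rw [hlin]
  have hneg : HasAllMoments (fun η => Real.exp (-W f η)) μ :=
    HasAllMoments.exp (hW.measurable f).neg.aemeasurable fun t => by
      simpa using hW.integrable_exp_mul f (-t)
  have hgm : AEStronglyMeasurable g μ := (hg 0).1
  have hkm := hW.measurable k
  have hfm := hW.measurable f
  have key := hasDerivAt_integral_of_dominated_loc_of_deriv_le (μ := μ)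
    (F := fun (t : ℝ) η => Real.exp (W k η + t * W f η) * g η)
    (F' := fun (t : ℝ) η => Real.exp (W k η + t * W f η) * W f η * g η) (x₀ := 0)
    (s := Metric.ball 0 1)
    -- For `|t| < 1`, `e^{tx} ≤ e^{|x|} ≤ e^x + e^{-x}`.
    (bound := fun η => Real.exp (W k η) * (Real.exp (W f η) + Real.exp (-W f η)) *
      (|W f η| * |g η|)) (Metric.ball_mem_nhds 0 one_pos)
    (Eventually.of_forall fun t => by
      refine AEStronglyMeasurable.mul ?_ hgm
      exact (by fun_prop : Measurable fun η => Real.exp (W k η + t * W f η)).aestronglyMeasurable)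
    (by simpa using ((hW.hasAllMoments_exp k).mul hg).integrable)
    (by
      refine AEStronglyMeasurable.mul ?_ hgm
      exact (by fun_prop : Measurable fun η =>
        Real.exp (W k η + 0 * W f η) * W f η).aestronglyMeasurable)
    (Eventually.of_forall fun η t ht => ?_)
    (((hW.hasAllMoments_exp k).mul ((hW.hasAllMoments_exp f).add hneg)).mul
      ((hW.hasAllMoments f).abs.mul hg.abs)).integrable
    (Eventually.of_forall fun η t _ => ?_)
  · convert! key.2 using 1
    refine integral_congr_ae (Eventually.of_forall fun η => ?_)
    simp only [zero_mul, add_zero]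
    ring
  · rw [norm_mul, norm_mul, Real.norm_eq_abs, Real.norm_eq_abs, Real.norm_eq_abs, Real.abs_exp,
      mul_assoc, Real.exp_add]
    refine mul_le_mul_of_nonneg_right (mul_le_mul_of_nonneg_left ?_ (Real.exp_pos _).le)
      (by positivity)
    have ht' : |t| ≤ 1 := by simpa using (Metric.mem_ball.1 ht).le
    have h1 : t * W f η ≤ |W f η| := by
      calc t * W f η ≤ |t * W f η| := le_abs_self _
        _ = |t| * |W f η| := abs_mul _ _
        _ ≤ 1 * |W f η| := by gcongr
        _ = |W f η| := one_mul _
    refine (Real.exp_le_exp.2 h1).trans ?_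
    rcases abs_cases (W f η) with ⟨h, _⟩ | ⟨h, _⟩ <;> rw [h] <;>
      linarith [Real.exp_pos (W f η), Real.exp_pos (-W f η)]
  · have h1 : HasDerivAt (fun t : ℝ => W k η + t * W f η) (W f η) t := by
      simpa using ((hasDerivAt_id t).mul_const (W f η)).const_add (W k η)
    exact h1.exp.mul_const _

theorem hasAllMoments_partitionSum (hW : IsWhiteNoise μ W) {n : ℕ} (f : Fin n → H) (c : Fin n → ℝ)
    (d : Finset (Fin n) → ℝ) (s : Finset (Fin n)) :
    HasAllMoments (fun η => partitionSum (pairWeight (fun i => W (f i) η + c i) d) s) μ := by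
  unfold partitionSum
  refine HasAllMoments.sum fun Q _ => HasAllMoments.prod fun B _ => ?_
  unfold pairWeight
  split_ifs
  · exact HasAllMoments.prod fun i _ => (hW.hasAllMoments _).add (.const _)
  · exact .const _
  · exact .const _

/-- By the recursion, adding `a` multiplies by `W (f a) + c a` and subtracts the pairings with `a`.
The factor `W (f a)` differentiates the formula for `s`: the Gaussian prefactor yields `⟨k, f a⟩`,
while the derivatives of the factors `⟨k, f b⟩ + c b` are exactly cancelled by the pairings. -/
theorem integral_exp_mul_partitionSum (hW : IsWhiteNoise μ W) {n : ℕ} (f : Fin n → H)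
    (c : Fin n → ℝ) (s : Finset (Fin n)) (k : H) :
    ∫ η, Real.exp (W k η) * partitionSum (pairWeight (fun i => W (f i) η + c i) (pairDelta f)) s ∂μ =
      Real.exp (‖k‖ ^ 2 / 2) * ∏ i ∈ s, (inner ℝ k (f i) + c i) := by
  classical
  -- The derivative in `k` needs the formula for all `k`; erasing a paired point needs strong
  -- induction.
  induction s using Finset.strongInduction generalizing k with
  | H s ih =>
  rcases s.eq_empty_or_nonempty with rfl | ⟨a, ha⟩
  · simp [partitionSum_empty, hW.integral_exp]
  obtain ⟨s, has, rfl⟩ : ∃ s', a ∉ s' ∧ insert a s' = s :=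
    ⟨s.erase a, Finset.notMem_erase a s, Finset.insert_erase ha⟩
  set Z : Finset (Fin n) → Ω → ℝ := fun s η =>
    partitionSum (pairWeight (fun i => W (f i) η + c i) (pairDelta f)) s with hZ
  have hZm : ∀ s, HasAllMoments (Z s) μ := hW.hasAllMoments_partitionSum f c _
  have ihs : ∀ k, ∫ η, Real.exp (W k η) * Z s η ∂μ =
      Real.exp (‖k‖ ^ 2 / 2) * ∏ i ∈ s, (inner ℝ k (f i) + c i) :=
    fun k => ih s (Finset.ssubset_insert has) k
  have ihb : ∀ b ∈ s, ∫ η, Real.exp (W k η) * Z (s.erase b) η ∂μ =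
      Real.exp (‖k‖ ^ 2 / 2) * ∏ i ∈ s.erase b, (inner ℝ k (f i) + c i) := fun b _ =>
    ih (s.erase b) ((Finset.erase_subset b s).trans_ssubset (Finset.ssubset_insert has)) k
  have hstep : ∫ η, Real.exp (W k η) * (W (f a) η * Z s η) ∂μ =
      Real.exp (‖k‖ ^ 2 / 2) * (inner ℝ k (f a) * ∏ i ∈ s, (inner ℝ k (f i) + c i) +
        ∑ b ∈ s, inner ℝ (f a) (f b) * ∏ i ∈ s.erase b, (inner ℝ k (f i) + c i)) := by
    have h1 := hW.hasDerivAt_integral_exp_mul k (f a) (hZm s)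
    simp only [ihs] at h1
    refine h1.unique ?_
    have hn : HasDerivAt (fun t : ℝ => Real.exp (‖k + t • f a‖ ^ 2 / 2))
        (Real.exp (‖k‖ ^ 2 / 2) * inner ℝ k (f a)) 0 := by
      have hq : ∀ t : ℝ, ‖k + t • f a‖ ^ 2 / 2 =
          ‖k‖ ^ 2 / 2 + t * inner ℝ k (f a) + t ^ 2 * (‖f a‖ ^ 2 / 2) := by
        intro t
        rw [norm_add_sq_real, inner_smul_right, norm_smul, mul_pow, Real.norm_eq_abs, sq_abs]
        ring
      simp only [hq]
      have h2 : HasDerivAt (fun t : ℝ => ‖k‖ ^ 2 / 2 + t * inner ℝ k (f a) +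
          t ^ 2 * (‖f a‖ ^ 2 / 2)) (inner ℝ k (f a)) 0 := by
        have := (((hasDerivAt_id (0 : ℝ)).mul_const (inner ℝ k (f a))).const_add
          (‖k‖ ^ 2 / 2)).fun_add ((hasDerivAt_pow 2 (0 : ℝ)).mul_const (‖f a‖ ^ 2 / 2))
        simpa using this
      simpa using h2.exp
    have hp : HasDerivAt (fun t : ℝ => ∏ i ∈ s, (inner ℝ (k + t • f a) (f i) + c i))
        (∑ b ∈ s, inner ℝ (f a) (f b) * ∏ i ∈ s.erase b, (inner ℝ k (f i) + c i)) 0 := by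
      have h3 : ∀ i ∈ s, HasDerivAt (fun t : ℝ => inner ℝ (k + t • f a) (f i) + c i)
          (inner ℝ (f a) (f i)) 0 := by
        intro i _
        simp only [inner_add_left, real_inner_smul_left]
        simpa using (((hasDerivAt_id (0 : ℝ)).mul_const (inner ℝ (f a) (f i))).const_add
          (inner ℝ k (f i))).add_const (c i)
      have := HasDerivAt.fun_finsetProd h3
      simpa [mul_comm] using this
    convert! hn.mul hp using 1
    simp only [zero_smul, add_zero]
    ring
  have hZi : ∀ η, Z (insert a s) η =
      W (f a) η * Z s η + c a * Z s η - ∑ b ∈ s, pairDelta f {a, b} * Z (s.erase b) η := by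
    intro η
    rw [← add_mul]
    exact partitionSum_pairWeight_insert _ _ has
  have hI : ∀ g : Ω → ℝ, HasAllMoments g μ → Integrable (fun η => Real.exp (W k η) * g η) μ :=
    fun g hg => ((hW.hasAllMoments_exp k).mul hg).integrable
  have hd : ∀ b ∈ s, pairDelta f {a, b} = inner ℝ (f a) (f b) := by
    intro b hb
    rw [inner_eq_integral, pairDelta]
    simp only [Finset.prod_pair (show a ≠ b from fun h => has (h ▸ hb))]
  have hfa := (hW.hasAllMoments (f a)).mul (hZm s)
  have hsplit : ∀ η, Real.exp (W k η) * Z (insert a s) η =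
      Real.exp (W k η) * (W (f a) η * Z s η) + c a * (Real.exp (W k η) * Z s η) -
        ∑ b ∈ s, pairDelta f {a, b} * (Real.exp (W k η) * Z (s.erase b) η) := by
    intro η
    rw [hZi, mul_sub, mul_add, Finset.mul_sum]
    congr 1
    · ring
    · exact Finset.sum_congr rfl fun b _ => mul_left_comm _ _ _
  have hi1 := hI _ hfa
  have hi2 := (hI _ (hZm s)).const_mul (c a)
  have hi3 : ∀ b ∈ s, Integrable (fun η =>
      pairDelta f {a, b} * (Real.exp (W k η) * Z (s.erase b) η)) μ :=
    fun b _ => (hI _ (hZm (s.erase b))).const_mul _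
  have hsum : ∑ b ∈ s, pairDelta f {a, b} * ∫ η, Real.exp (W k η) * Z (s.erase b) η ∂μ =
      Real.exp (‖k‖ ^ 2 / 2) *
        ∑ b ∈ s, inner ℝ (f a) (f b) * ∏ i ∈ s.erase b, (inner ℝ k (f i) + c i) := by
    rw [Finset.mul_sum]
    refine Finset.sum_congr rfl fun b hb => ?_
    rw [hd b hb, ihb b hb]
    ring
  calc _ = ∫ η, (Real.exp (W k η) * (W (f a) η * Z s η) + c a * (Real.exp (W k η) * Z s η) -
        ∑ b ∈ s, pairDelta f {a, b} * (Real.exp (W k η) * Z (s.erase b) η)) ∂μ :=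
      integral_congr_ae (Eventually.of_forall hsplit)
    _ = _ := by
      rw [integral_sub (hi1.fun_add hi2) (integrable_finsetSum _ hi3), integral_add hi1 hi2,
        integral_finsetSum _ hi3]
      simp only [integral_const_mul]
      rw [hstep, ihs, hsum, Finset.prod_insert has]
      ring

end IsWhiteNoise

/-! ### The kernel and the isometry tested against Gaussian exponentials -/

namespace IsWhiteNoise

variable {Ω : Type*} [MeasurableSpace Ω] {μ : Measure Ω} {W : H → Ω → ℝ}

/-- The factor `e^{-⟨1, η⟩}` of the kernel merges with the test exponential, shifting `k` to `k -
1`. -/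
theorem kernel_ae_eq (hW : IsWhiteNoise μ W) {n : ℕ} (f : Fin n → H) (k : H) :
    (fun η => Real.exp (W k η - ‖k‖ ^ 2 / 2) * kernel W n f η) =ᵐ[μ]
      fun η => Real.exp (-1 / 2 - ‖k‖ ^ 2 / 2) *
        (Real.exp (W (k - Lp.const 2 volume 1) η) *
          partitionSum (pairWeight (fun i => W (f i) η + 2 * ∫ x, f i x) (pairDelta f))
            Finset.univ) := by
  filter_upwards [hW.sub_ae_eq k (Lp.const 2 volume 1)] with η h1
  rw [h1, kernel, sum_partitionsLeTwo_eq, ← mul_assoc, ← mul_assoc, ← Real.exp_add, ← Real.exp_add]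
  unfold noisePlusTwo
  ring_nf

variable [IsProbabilityMeasure μ]

/-! ### Exponential functionals of white noise -/

theorem memLp_exp_sub (hW : IsWhiteNoise μ W) (h : H) :
    MemLp (fun η => Real.exp (W h η - ‖h‖ ^ 2 / 2)) 2 μ := by
  simp only [sub_eq_add_neg, Real.exp_add]
  exact (hW.hasAllMoments_exp h).memLp_two.mul_const _

/-- The functional `exp (⟨h, η⟩ - ‖h‖² / 2)` as an element of `L²(α)`. -/
noncomputable def gaussExp (hW : IsWhiteNoise μ W) (h : H) : Lp ℂ 2 μ :=
  ((hW.memLp_exp_sub h).ofReal (K := ℂ)).toLp _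

theorem coeFn_gaussExp (hW : IsWhiteNoise μ W) (h : H) :
    hW.gaussExp h =ᵐ[μ] fun η => (Real.exp (W h η - ‖h‖ ^ 2 / 2) : ℂ) := MemLp.coeFn_toLp _

theorem inner_gaussExp (hW : IsWhiteNoise μ W) (h k : H) :
    inner ℂ (hW.gaussExp h) (hW.gaussExp k) = (Real.exp (inner ℝ h k) : ℂ) := by
  have h1 : inner ℂ (hW.gaussExp h) (hW.gaussExp k) =
      ∫ η, ((Real.exp (W (h + k) η) * Real.exp (-(‖h‖ ^ 2 / 2) - ‖k‖ ^ 2 / 2) : ℝ) : ℂ) ∂μ := by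
    rw [L2.inner_def]
    refine integral_congr_ae ?_
    filter_upwards [hW.coeFn_gaussExp h, hW.coeFn_gaussExp k, hW.add_ae_eq h k] with η h1 h2 h3
    rw [h1, h2, h3, RCLike.inner_apply, Complex.conj_ofReal, ← Complex.ofReal_mul, ← Real.exp_add,
      ← Real.exp_add]
    ring_nf
  rw [h1, integral_complex_ofReal, integral_mul_const, hW.integral_exp, ← Real.exp_add,
    norm_add_sq_real]
  ring_nf

/-- By almost sure linearity, the exponential of any finite combination of the `W h` is a nonzero
multiple of a single `gaussExp`. -/
theorem eq_zero_of_inner_gaussExp_eq_zero (hW : IsWhiteNoise μ W) {G : Lp ℂ 2 μ}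
    (hG : ∀ h, inner ℂ (hW.gaussExp h) G = 0) : G = 0 := by
  rw [Lp.eq_zero_iff_ae_eq_zero]
  refine ae_eq_zero_of_integral_mul_cexp_eq_zero (X := W) hW.measurable (fun I t => ?_)
    hW.generates (Lp.memLp G) fun I t => ?_
  · refine ((hW.hasAllMoments_exp (∑ h ∈ I, t h • h)).memLp_two.ae_eq ?_)
    filter_upwards [hW.sum_ae_eq I t] with η h1
    rw [h1]
  · set h := ∑ h ∈ I, t h • h
    have h1 := hG h
    rw [L2.inner_def] at h1
    have h2 : ∫ η, (Real.exp (-(‖h‖ ^ 2 / 2)) : ℂ) *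
        ((Real.exp (∑ h ∈ I, t h * W h η) : ℂ) * G η) ∂μ = 0 := by
      rw [← h1]
      refine integral_congr_ae ?_
      filter_upwards [hW.sum_ae_eq I t, hW.coeFn_gaussExp h] with η h3 h4
      rw [h4, h3, RCLike.inner_apply, Complex.conj_ofReal, sub_eq_add_neg, Real.exp_add]
      push_cast
      ring
    rw [integral_const_mul] at h2
    exact (mul_eq_zero.1 h2).resolve_left (by simp [Complex.exp_ne_zero])

/-! ### The kernel on products of functions -/

variable {n : ℕ}

theorem memLp_kernel (hW : IsWhiteNoise μ W) (f : Fin n → H) : MemLp (kernel W n f) 2 μ := by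
  have h1 : MemLp (fun η => Real.exp (-1 / 2 - ‖(0 : H)‖ ^ 2 / 2) *
        (Real.exp (W (0 - Lp.const 2 volume 1) η) *
          partitionSum (pairWeight (fun i => W (f i) η + 2 * ∫ x, f i x) (pairDelta f))
            Finset.univ)) 2 μ :=
    (((hW.hasAllMoments_exp _).mul (hW.hasAllMoments_partitionSum f _ _ _)).memLp_two).const_mul _
  refine h1.ae_eq ?_
  have h0 : W 0 =ᵐ[μ] fun _ => 0 := by simpa using hW.linear 0 0 0 0
  filter_upwards [hW.kernel_ae_eq f 0, h0] with η h2 h3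
  rw [← h2, h3]
  simp

/-- The random variable `⟨K({x₁, …, xₙ}, η), f₁ ⊗ ⋯ ⊗ fₙ⟩` as an element of `L²(α)`. -/
noncomputable def kernelLp (hW : IsWhiteNoise μ W) (f : Fin n → H) : Lp ℂ 2 μ :=
  ((hW.memLp_kernel f).ofReal (K := ℂ)).toLp _

theorem coeFn_kernelLp (hW : IsWhiteNoise μ W) (f : Fin n → H) :
    hW.kernelLp f =ᵐ[μ] fun η => (kernel W n f η : ℂ) := MemLp.coeFn_toLp _

theorem inner_gaussExp_kernelLp (hW : IsWhiteNoise μ W) (k : H) (f : Fin n → H) :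
    inner ℂ (hW.gaussExp k) (hW.kernelLp f) =
      ((Real.exp (-∫ x, k x) * ∏ i, ∫ x, (1 + k x) * f i x : ℝ) : ℂ) := by
  have hone : (Lp.const 2 (volume : Measure unitInterval) (1 : ℝ) : H) =ᵐ[volume] fun _ => 1 :=
    Lp.coeFn_const ..
  have hinner : ∀ h : H, inner ℝ (Lp.const 2 volume (1 : ℝ) : H) h = ∫ x, h x := fun h => by
    rw [inner_eq_integral]
    refine integral_congr_ae ?_
    filter_upwards [hone] with x hx
    rw [hx, one_mul]
  have hnorm : ‖(Lp.const 2 volume (1 : ℝ) : H)‖ ^ 2 = 1 := by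
    rw [← real_inner_self_eq_norm_sq, hinner, integral_congr_ae hone]
    simp
  have h1 : inner ℂ (hW.gaussExp k) (hW.kernelLp f) =
      ∫ η, ((Real.exp (W k η - ‖k‖ ^ 2 / 2) * kernel W n f η : ℝ) : ℂ) ∂μ := by
    rw [L2.inner_def]
    refine integral_congr_ae ?_
    filter_upwards [hW.coeFn_gaussExp k, hW.coeFn_kernelLp f] with η h1 h2
    rw [h1, h2, RCLike.inner_apply, Complex.conj_ofReal, mul_comm, Complex.ofReal_mul]
  rw [h1, integral_complex_ofReal, integral_congr_ae (hW.kernel_ae_eq f k), integral_const_mul,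
    hW.integral_exp_mul_partitionSum, ← mul_assoc, ← Real.exp_add, norm_sub_sq_real, hnorm,
    real_inner_comm, hinner]
  -- The exponent is `-1/2 - ‖k‖²/2 + ‖k - 1‖²/2 = -∫ k`, and each factor is `⟨k - 1, fᵢ⟩ + 2 ∫ fᵢ =
  -- ∫ (1 + k) fᵢ`.
  congr 2
  · congr 1
    ring
  · refine Finset.prod_congr rfl fun i _ => ?_
    rw [inner_sub_left, hinner, inner_eq_integral]
    have : ∀ x, (1 + k x) * f i x = f i x + k x * f i x := fun x => by ring
    simp only [this]
    rw [integral_add (integrable_coeFn (f i)) (integrable_mul_coeFn k (f i))]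
    ring

/-! ### The canonical isometry and its kernel -/

theorem isCanonicalIsometry_iff (hW : IsWhiteNoise μ W)
    (U : Lp ℂ 2 μ ≃ₗᵢ[ℂ] Lp ℂ 2 uniformMixture) :
    IsCanonicalIsometry W U ↔ ∀ h, U (hW.gaussExp h) = poissonExp h := by
  constructor
  · intro hU h
    exact Lp.ext ((hU h _ (hW.coeFn_gaussExp h)).trans (coeFn_poissonExp h).symm)
  · intro hU h E hE
    have : E = hW.gaussExp h := Lp.ext (hE.trans (hW.coeFn_gaussExp h).symm)
    rw [this, hU]
    exact coeFn_poissonExp h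

theorem existsUnique_isCanonicalIsometry (hW : IsWhiteNoise μ W) :
    ∃! U : Lp ℂ 2 μ ≃ₗᵢ[ℂ] Lp ℂ 2 uniformMixture, IsCanonicalIsometry W U := by
  simp only [hW.isCanonicalIsometry_iff]
  have htot : ∀ G, (∀ h, inner ℂ (hW.gaussExp h) G = 0) → G = 0 :=
    fun G => hW.eq_zero_of_inner_gaussExp_eq_zero
  obtain ⟨U, hU⟩ := exists_linearIsometryEquiv_of_inner_eq htot
    (fun F => eq_zero_of_inner_poissonExp_eq_zero)
    (fun h k => (hW.inner_gaussExp h k).trans (inner_poissonExp h k).symm)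
  refine ⟨U, hU, fun V hV => ?_⟩
  have hfun : (V : Lp ℂ 2 μ → Lp ℂ 2 uniformMixture) = U := by
    refine (denseRange_linearCombination htot).equalizer V.continuous U.continuous ?_
    ext1 T
    simp only [Function.comp_apply, Finsupp.linearCombination_apply, Finsupp.sum, map_sum, map_smul,
      hV, hU]
  exact LinearIsometryEquiv.ext (congrFun hfun)

variable {U : Lp ℂ 2 μ ≃ₗᵢ[ℂ] Lp ℂ 2 uniformMixture}

/-- Both sides have the same inner products with the total family `gaussExp`; this identifies the
kernel on products. -/
theorem symm_adjoint_sector_prodLp (hW : IsWhiteNoise μ W) (hU : IsCanonicalIsometry W U)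
    (f : Fin n → H) : U.symm ((sector n).adjoint (prodLp f)) = hW.kernelLp f := by
  rw [hW.isCanonicalIsometry_iff] at hU
  refine ext_of_forall_inner_eq (fun G => hW.eq_zero_of_inner_gaussExp_eq_zero) fun k => ?_
  rw [hW.inner_gaussExp_kernelLp, ← inner_poissonExp_adjoint_sector, ← hU k,
    ← U.inner_map_map, U.apply_symm_apply]

theorem symm_adjoint_sector_linearCombination (hW : IsWhiteNoise μ W)
    (hU : IsCanonicalIsometry W U) (T : (Fin n → H) →₀ ℂ) :
    U.symm ((sector n).adjoint (Finsupp.linearCombination ℂ prodLp T)) =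
      Finsupp.linearCombination ℂ hW.kernelLp T := by
  simp only [Finsupp.linearCombination_apply, Finsupp.sum, map_sum, map_smul,
    hW.symm_adjoint_sector_prodLp hU]

/-- On combinations of products the kernel acts as the bounded operator `U⁻¹ Sₙ*`. These
combinations are dense, so the closure of the graph is the graph of that operator. -/
theorem hasSectorIntegral_iff (hW : IsWhiteNoise μ W) (hU : IsCanonicalIsometry W U)
    (u : Lp ℂ 2 (volume : Measure (Fin n → unitInterval))) {v : (Fin n → unitInterval) → ℂ}
    (hv : u =ᵐ[volume] v) (G : Lp ℂ 2 μ) :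
    (kernel W).HasSectorIntegral n v G ↔ G = U.symm ((sector n).adjoint u) := by
  have h1 : ∀ T : ℕ → ((Fin n → H) →₀ ℂ),
      Tendsto (fun k => eLpNorm (fun x => testFun (T k) x - v x) 2 volume) atTop (𝓝 0) ↔
        Tendsto (fun k => Finsupp.linearCombination ℂ prodLp (T k)) atTop (𝓝 u) := by
    intro T
    rw [Lp.tendsto_Lp_iff_tendsto_eLpNorm']
    refine tendsto_congr fun k => eLpNorm_congr_ae ?_
    filter_upwards [coeFn_linearCombination coeFn_prodLp (T k), hv] with x h1 h2
    rw [Pi.sub_apply, h1, h2]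
    rfl
  have h2 : ∀ T : ℕ → ((Fin n → H) →₀ ℂ),
      Tendsto (fun k => eLpNorm (fun η => (kernel W).apply (T k) η - G η) 2 μ) atTop (𝓝 0) ↔
        Tendsto (fun k => U.symm ((sector n).adjoint (Finsupp.linearCombination ℂ prodLp (T k))))
          atTop (𝓝 G) := by
    intro T
    rw [Lp.tendsto_Lp_iff_tendsto_eLpNorm']
    refine tendsto_congr fun k => eLpNorm_congr_ae ?_
    rw [hW.symm_adjoint_sector_linearCombination hU]
    filter_upwards [coeFn_linearCombination hW.coeFn_kernelLp (T k)] with x h1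
    rw [Pi.sub_apply, h1]
    rfl
  have hc : Continuous fun w => U.symm ((sector n).adjoint w) :=
    U.symm.continuous.comp (sector n).adjoint.continuous
  simp only [GenKernel.HasSectorIntegral, h1, h2]
  constructor
  · rintro ⟨T, hT1, hT2⟩
    exact tendsto_nhds_unique hT2 ((hc.tendsto u).comp hT1)
  · rintro rfl
    obtain ⟨w, hw, hwu⟩ := mem_closure_iff_seq_limit.1 (denseRange_linearCombination
      (fun w => eq_zero_of_inner_prodLp_eq_zero (n := n) (u := w)) u)
    choose T hT using hw
    obtain rfl : (fun k => Finsupp.linearCombination ℂ prodLp (T k)) = w := funext hT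
    exact ⟨T, hwu, (hc.tendsto u).comp hwu⟩

/-- Each sector integral is forced to be `U⁻¹ Sₙ* Sₙ F`, and the series is the image under `U⁻¹` of
the Parseval expansion of `F`. -/
theorem hasIntegral_iff (hW : IsWhiteNoise μ W) (hU : IsCanonicalIsometry W U)
    (F : Lp ℂ 2 uniformMixture) (G : Lp ℂ 2 μ) :
    (kernel W).HasIntegral F G ↔ G = U.symm F := by
  have hs := (hasSum_sectorWeight_smul_adjoint_sector F).mapL
    (U.symm.toContinuousLinearEquiv : Lp ℂ 2 uniformMixture →L[ℂ] Lp ℂ 2 μ)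
  have hsum : HasSum (fun n => ((Real.exp (-1) / (n ! : ℝ) : ℝ) : ℂ) •
      U.symm ((sector n).adjoint (sector n F))) (U.symm F) := by
    convert! hs using 2 with n
    rw [map_smul]
    rfl
  simp only [GenKernel.HasIntegral,
    fun n => hW.hasSectorIntegral_iff hU (sector n F) (coeFn_sector n F)]
  constructor
  · rintro ⟨g, hg, hG⟩
    obtain rfl : g = _ := funext hg
    exact hG.unique hsum
  · rintro rfl
    exact ⟨_, fun n => rfl, hsum⟩

end IsWhiteNoise

end PoissonGauss

theorem theorem3p2 {Ω : Type*} [MeasurableSpace Ω] (μ : Measure Ω) [IsProbabilityMeasure μ]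
    (W : H → Ω → ℝ) (hW : IsWhiteNoise μ W)
    (P : Measure Config) [IsProbabilityMeasure P] (hP : IsPoissonProcess P) :
    (∃! Φ : Lp ℂ 2 μ ≃ₗᵢ[ℂ] Lp ℂ 2 P, IsCanonicalIsometry W Φ) ∧
      ∀ Φ : Lp ℂ 2 μ ≃ₗᵢ[ℂ] Lp ℂ 2 P, IsCanonicalIsometry W Φ →
        ∀ (F : Lp ℂ 2 P) (G : Lp ℂ 2 μ), (kernel W).HasIntegral F G ↔ G = Φ.symm F := by
  obtain rfl := hP.eq_uniformMixture
  exact ⟨hW.existsUnique_isCanonicalIsometry, fun _ hΦ F G => hW.hasIntegral_iff hΦ F G⟩
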